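/- Let $n\ge 2$ be an even integer, $p=n/2$, $\nu>0$ and $0<\gamma_{\mathrm{pf}}<2$. On points $(X,\Sigma_\phi,T)\in\mathbb{R}^3$ put $$\Omega_\phi=\Sigma_\phi^2+X^{2n},\qquad \Omega_{\mathrm{pf}}=1-\Omega_\phi,\qquad q=-1+3\Sigma_\phi^2+\tfrac32\gamma_{\mathrm{pf}}\Omega_{\mathrm{pf}},$$ and consider the autonomous system $$\begin{aligned} \frac{dX}{d\tau}&=\tfrac1n(1+q)(1-T)X+T\Sigma_\phi,\\ \frac{d\Sigma_\phi}{d\tau}&=-(2-q)(1-T)\Sigma_\phi-nTX^{2n-1}-\nu(1-T)X^{n}\Sigma_\phi,\\ \frac{dT}{d\tau}&=\tfrac1n(1+q)T(1-T)^2, \end{aligned}$$ with state space $\mathbf S=\{(X,\Sigma_\phi,T): 0<\Omega_\phi<1,\ 0<T<1\}$. Through every point of $\mathbf S$ there is a solution that exists and stays in $\mathbf S$ for all later times, and the following holds. (i) If $0<\gamma_{\mathrm{pf}}\le \frac{2n}{n+1}$, then every solution starting in $\mathbf S$ converges, as $\tau\to+\infty$, to the fixed point $\mathrm{FL}_1=(0,0,1)$,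 at which $\Omega_{\mathrm{pf}}=1$. (ii) If $\frac{2n}{n+1}<\gamma_{\mathrm{pf}}<2$, then there is $c\in(0,1)$, depending only on $n,\nu,\gamma_{\mathrm{pf}}$, such that $\mathcal P_c=\{T=1,\ \Omega_\phi=c\}$ is a (nonconstant) periodic orbit of the system and every solution starting in $\mathbf S$ converges to $\mathcal P_c$ as $\tau\to+\infty$: its distance to $\mathcal P_c$ tends to $0$ and its $\omega$-limit set is $\mathcal P_c$. -/

import Mathlib

open Set Filter Topology

noncomputable section

namespace ScalarFluid

/-- Points are triples `(X, Σ_φ, T)`. -/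
abbrev State : Type := ℝ × ℝ × ℝ

/-- Hubble-normalized scalar field energy density `Ω_φ = Σ_φ² + X^{2n}`. -/
def omegaPhi (n : ℕ) (x : State) : ℝ := x.2.1 ^ 2 + x.1 ^ (2 * n)

/-- Hubble-normalized fluid energy density `Ω_pf = 1 - Ω_φ`. -/
def omegaPf (n : ℕ) (x : State) : ℝ := 1 - omegaPhi n x

/-- Deceleration parameter `q = -1 + 3 Σ_φ² + (3/2) γ_pf Ω_pf`. -/
def decel (n : ℕ) (γ : ℝ) (x : State) : ℝ :=
  -1 + 3 * x.2.1 ^ 2 + 3 / 2 * γ * omegaPf n x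

/-- Right-hand side of the global dynamical system in the case `p = n / 2`
(the interaction exponent `2 p` is then equal to `n`). -/
def field (n : ℕ) (γ ν : ℝ) (x : State) : State :=
  let X := x.1
  let S := x.2.1
  let T := x.2.2
  let q := decel n γ x
  (1 / (n : ℝ) * (1 + q) * (1 - T) * X + T * S,
    -(2 - q) * (1 - T) * S - (n : ℝ) * T * X ^ (2 * n - 1) - ν * (1 - T) * X ^ n * S,
    1 / (n : ℝ) * (1 + q) * T * (1 - T) ^ 2)

/-- The state space: an open solid cylinder without its axis. -/
def stateSpace (n : ℕ) : Set State :=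
  {x | 0 < omegaPhi n x ∧ omegaPhi n x < 1 ∧ 0 < x.2.2 ∧ x.2.2 < 1}

/-- `u` solves `du/dτ = F u` on `[τ₀, ∞)`. -/
def IsForwardSolution (F : State → State) (τ₀ : ℝ) (u : ℝ → State) : Prop :=
  ∀ τ ∈ Ici τ₀, HasDerivWithinAt u (F (u τ)) (Ici τ₀) τ

/-- The fixed point `FL₁`. -/
def FL1 : State := (0, 0, 1)

/-- The level set `Ω_φ = c` in the boundary `T = 1`. -/
def levelOrbit (n : ℕ) (c : ℝ) : Set State :=
  {x | x.2.2 = 1 ∧ omegaPhi n x = c}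

/-- `P` is the image of a nonconstant periodic solution of `dv/dτ = F v`. -/
def IsPeriodicOrbit (F : State → State) (P : Set State) : Prop :=
  ∃ (v : ℝ → State) (L : ℝ), (∀ τ, HasDerivAt v (F (v τ)) τ) ∧ 0 < L ∧
    Function.Periodic v L ∧ (∃ τ, v τ ≠ v 0) ∧ range v = P

/-- The distance from `u τ` to `P` tends to zero, and the `ω`-limit set of `u` is all of `P`. -/
def ConvergesToSet (u : ℝ → State) (P : Set State) : Prop :=
  Tendsto (fun τ => Metric.infDist (u τ) P) atTop (𝓝 0) ∧
    {z | MapClusterPt z atTop u} = P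

end ScalarFluid

end

noncomputable section

namespace ScalarFluid

/-! ### Differential inequalities on the real line -/

/-! On `T = 1` the system is the Hamiltonian oscillator `X' = Σ`, `Σ' = -n X^(2n-1)`, whose energy
`Ω_φ` is conserved and whose positive energy levels are periodic orbits. In general `Ω_φ' = (1 - T)
* slowRate`, so once `T → 1` the energy drifts slowly and its fate is decided by the average of
`slowRate` over an energy level.

That `T → 1` (`IsOrbit.tendsto_clock`) comes from the clock `log (T / (1 - T))`, with rate `(1 +
q)(1 - T) / n`: if it stayed bounded, `1 + q` would be integrable in time, while the derivative of
`XΣ` is strictly negative up to a multiple of `1 + q`, contradicting the boundedness of `XΣ`.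

Averaging (`IsOrbit.exists_averaged`) replaces `Ω_φ` by `Y = Ω_φ - e B` with `e = (1 - T) / T → 0`,
where the derivative of `B` along the oscillator cancels the oscillating part of `slowRate` up to a
small error. Correctors for powers of `X^(2n)` come from virial identities; `X^n Σ²` is reached by
approximating the square root by polynomials, and its exact mean `K E^(3/2)` comes from the scaling
of the periodic orbits. The resulting `meanRate` is `3E(1-E)(γ - 2n/(n+1)) - 2νK E^(3/2)`. Below or
at the critical `γ` it is negative for `0 < E ≤ 1`, so `Ω_φ → 0`. Above, it has one zero `c` in `(0,
1)`, positive to the left and negative to the right, so `Ω_φ → c` provided `Ω_φ` stays away from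
`0`.

That proviso is not covered by averaging, whose error is not proportional to `Ω_φ`. It is obtained
in `IsOrbit.exists_eventually_omegaPhi_ge` from the Lyapunov function `Ω_φ + α w Σ + β w²` with `w =
e X`. Finally, convergence of `Ω_φ` and `T`, together with continuous dependence on initial data,
makes the whole level set the `ω`-limit set. -/

lemma le_of_hasDerivAt_nonneg {f f' : ℝ → ℝ} {a b : ℝ} (hab : a ≤ b)
    (hc : ContinuousOn f (Icc a b)) (hd : ∀ t ∈ Ioo a b, HasDerivAt f (f' t) t)
    (h : ∀ t ∈ Ioo a b, 0 ≤ f' t) : f a ≤ f b := by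
  have hm : MonotoneOn f (Icc a b) := by
    apply monotoneOn_of_deriv_nonneg (convex_Icc a b) hc
    · rw [interior_Icc]
      exact fun t ht => (hd t ht).differentiableAt.differentiableWithinAt
    · rw [interior_Icc]
      intro t ht
      rw [(hd t ht).deriv]
      exact h t ht
  exact hm (left_mem_Icc.2 hab) (right_mem_Icc.2 hab) hab

/-- A function that does not decrease while it is below the level `m` never falls below
the minimum of its initial value and `m`. -/
lemma min_le_of_deriv_nonneg_below {f f' : ℝ → ℝ} {a m : ℝ}
    (hd : ∀ t, a ≤ t → HasDerivAt f (f' t) t)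
    (h : ∀ t, a ≤ t → f t < m → 0 ≤ f' t) {b : ℝ} (hb : a ≤ b) : min (f a) m ≤ f b := by
  by_contra! hlt
  have hcont : ContinuousOn f (Icc a b) := fun t ht =>
    (hd t ht.1).continuousAt.continuousWithinAt
  -- `σ = sSup A` is the last time at which `f` is at least the minimum; after it `f < m`, so `f`
  -- cannot decrease.
  set A : Set ℝ := Icc a b ∩ f ⁻¹' Ici (min (f a) m) with hA
  have hAc : IsCompact A :=
    isCompact_Icc.of_isClosed_subset (hcont.preimage_isClosed_of_isClosed isClosed_Icc isClosed_Ici)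
      inter_subset_left
  have hAn : A.Nonempty := ⟨a, left_mem_Icc.2 hb, show min (f a) m ≤ f a from min_le_left _ _⟩
  obtain ⟨⟨h1, h2⟩, h3⟩ := hAc.sSup_mem hAn
  set σ := sSup A
  have hnot : ∀ t ∈ Ioc σ b, f t < min (f a) m := by
    intro t ht
    by_contra! h4
    have : t ∈ A := ⟨⟨h1.trans ht.1.le, ht.2⟩, h4⟩
    exact absurd (le_csSup hAc.bddAbove this) (not_le.2 ht.1)
  have := le_of_hasDerivAt_nonneg h2 (hcont.mono (Icc_subset_Icc_left h1))
    (fun t ht => hd t (h1.trans ht.1.le))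
    (fun t ht => h t (h1.trans ht.1.le)
      ((hnot t ⟨ht.1, ht.2.le⟩).trans_le (min_le_right _ _)))
  exact absurd (lt_of_le_of_lt this hlt) (not_lt.2 h3)

/-- If `f` decreases at least at a fixed fraction of the rate at which `L → ∞` increases as long
as `f ≥ m`, then eventually `f ≤ m`. -/
lemma eventually_le_of_drift {f f' L L' : ℝ → ℝ} {κ m : ℝ} (hκ : 0 < κ)
    (hf : ∀ᶠ t in atTop, HasDerivAt f (f' t) t) (hL : ∀ᶠ t in atTop, HasDerivAt L (L' t) t)
    (hL0 : ∀ᶠ t in atTop, 0 ≤ L' t) (hLtop : Tendsto L atTop atTop)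
    (h : ∀ᶠ t in atTop, m ≤ f t → f' t ≤ -κ * L' t) : ∀ᶠ t in atTop, f t ≤ m := by
  obtain ⟨a, ha⟩ := eventually_atTop.1 (hf.and (hL.and (hL0.and h)))
  -- If `f > m` for ever, then `f + κ L` is nonincreasing and `L → ∞` forces `f` below `m`. Once at
  -- most `m`, the previous lemma applied to `-f` keeps it there.
  have hex : ∃ b, a ≤ b ∧ f b ≤ m := by
    by_contra! hgt
    have hmono : ∀ t, a ≤ t → f t + κ * L t ≤ f a + κ * L a := by
      intro t ht
      have hd : ∀ s, a ≤ s →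
          HasDerivAt (fun s => -(f s + κ * L s)) (-(f' s + κ * L' s)) s := fun s hs =>
        ((ha s hs).1.add ((ha s hs).2.1.const_mul κ)).neg
      have := le_of_hasDerivAt_nonneg ht (fun s hs => (hd s hs.1).continuousAt.continuousWithinAt)
        (fun s hs => hd s hs.1.le) (fun s hs => by
          have := (ha s hs.1.le).2.2.2 (hgt s hs.1.le).le
          linarith)
      linarith
    obtain ⟨t, ht, hta⟩ := ((hLtop.eventually_gt_atTop ((f a + κ * L a - m) / κ)).and
      (eventually_ge_atTop a)).exists
    rw [div_lt_iff₀ hκ] at ht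
    have := hmono t hta
    have := hgt t hta
    linarith
  obtain ⟨b, hab, hb⟩ := hex
  filter_upwards [eventually_ge_atTop b] with t ht
  have := min_le_of_deriv_nonneg_below (f := fun s => -f s) (f' := fun s => -f' s) (a := b)
    (m := -m) (fun s hs => (ha s (hab.trans hs)).1.neg) (fun s hs hlt => by
      have h1 := ha s (hab.trans hs)
      have h2 := h1.2.2.2 (by linarith)
      have h3 := mul_nonneg hκ.le h1.2.2.1
      linarith) ht
  have h5 : min (-f b) (-m) = -m := min_eq_right (by linarith)
  rw [h5] at this
  linarith

/-- A positive function whose logarithmic derivative is bounded below stays positive. -/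
lemma pos_of_deriv_ge_neg_mul {f f' : ℝ → ℝ} {a b C : ℝ} (hab : a ≤ b)
    (hc : ContinuousOn f (Icc a b)) (hd : ∀ t ∈ Ioo a b, HasDerivAt f (f' t) t)
    (h : ∀ t ∈ Ioo a b, -C * f t ≤ f' t) (ha : 0 < f a) : 0 < f b := by
  have hE : ∀ t, HasDerivAt (fun t => Real.exp (C * t)) (Real.exp (C * t) * C) t := fun t => by
    simpa using ((hasDerivAt_id t).const_mul C).exp
  have := le_of_hasDerivAt_nonneg (f := fun t => Real.exp (C * t) * f t) hab
    (ContinuousOn.mul (by fun_prop) hc) (fun t ht => (hE t).mul (hd t ht)) (fun t ht => by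
      have h1 := h t ht
      have h2 := Real.exp_pos (C * t)
      have : Real.exp (C * t) * C * f t + Real.exp (C * t) * f' t
        = Real.exp (C * t) * (f' t + C * f t) := by ring
      rw [this]
      exact mul_nonneg h2.le (by linarith))
  have h3 : 0 < Real.exp (C * b) * f b := lt_of_lt_of_le (mul_pos (Real.exp_pos _) ha) this
  exact (mul_pos_iff_of_pos_left (Real.exp_pos _)).1 h3

/-- A curve that leaves an open set does so at a first time. -/
lemma exists_first_exit {E : Type*} [TopologicalSpace E] {u : ℝ → E} {S : Set E} {a b : ℝ}
    (hS : IsOpen S) (hu : ContinuousOn u (Ici a)) (ha : u a ∈ S) (hab : a ≤ b) (hb : u b ∉ S) :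
    ∃ c, a < c ∧ u c ∉ S ∧ ∀ t ∈ Ico a c, u t ∈ S := by
  set A : Set ℝ := Icc a b ∩ u ⁻¹' Sᶜ
  have hAc : IsCompact A := isCompact_Icc.of_isClosed_subset
    ((hu.mono Icc_subset_Ici_self).preimage_isClosed_of_isClosed isClosed_Icc hS.isClosed_compl)
    inter_subset_left
  obtain ⟨⟨h1, h2⟩, h3⟩ := hAc.sInf_mem ⟨b, right_mem_Icc.2 hab, hb⟩
  refine ⟨sInf A, lt_of_le_of_ne h1 ?_, h3, fun t ht => ?_⟩
  · intro h
    rw [← h] at h3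
    exact h3 ha
  · by_contra h
    exact absurd (csInf_le hAc.bddBelow (⟨⟨ht.1, ht.2.le.trans h2⟩, h⟩ : t ∈ A)) (not_le.2 ht.2)

/-! ### Global solutions of truncated autonomous equations -/

section Global
variable {E : Type*} [NormedAddCommGroup E] [NormedSpace ℝ E]

/-- A field bounded by `M` moves a point by at most `M N` in time `N`, so Picard–Lindelöf applies on
every interval of radius `N`; uniqueness glues the local solutions. -/
lemma exists_global_solution [CompleteSpace E] {F : E → E} {K : NNReal} {M : ℝ}
    (hF : LipschitzWith K F) (hM : ∀ x, ‖F x‖ ≤ M) (t₀ : ℝ) (x₀ : E) :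
    ∃ u : ℝ → E, u t₀ = x₀ ∧ ∀ t, HasDerivAt u (F (u t)) t := by
  have hM0 : 0 ≤ M := (norm_nonneg _).trans (hM x₀)
  have key : ∀ N : ℝ, ∃ u : ℝ → E, 0 < N → u t₀ = x₀ ∧
      ∀ t ∈ Ioo (t₀ - N) (t₀ + N), HasDerivAt u (F (u t)) t := by
    intro N
    by_cases hN : 0 < N
    · have hP : IsPicardLindelof (fun _ => F) (tmin := t₀ - N) (tmax := t₀ + N)
          ⟨t₀, by constructor <;> linarith⟩ x₀ (M.toNNReal * N.toNNReal) 0 M.toNNReal K := by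
        apply IsPicardLindelof.of_time_independent
        · intro x _
          rw [Real.coe_toNNReal _ hM0]
          exact hM x
        · exact hF.lipschitzOnWith
        · simp [Real.coe_toNNReal _ hM0, Real.coe_toNNReal _ hN.le]
      obtain ⟨u, hu0, hu⟩ := hP.exists_eq_forall_mem_Icc_hasDerivWithinAt₀
      exact ⟨u, fun _ => ⟨hu0, fun t ht =>
        (hu t (Ioo_subset_Icc_self ht)).hasDerivAt (Icc_mem_nhds ht.1 ht.2)⟩⟩
    · exact ⟨fun _ => x₀, fun h => absurd h hN⟩
  choose u hu using key
  have huniq : ∀ N N' : ℝ, 0 < N → N ≤ N' → EqOn (u N) (u N') (Ioo (t₀ - N) (t₀ + N)) := by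
    intro N N' hN hNN
    refine ODE_solution_unique_of_mem_Ioo (v := fun _ => F) (s := fun _ => univ) (K := K)
      (t₀ := t₀) (fun t _ => hF.lipschitzOnWith) ⟨by linarith, by linarith⟩
      (fun t ht => ⟨(hu N hN).2 t ht, mem_univ _⟩)
      (fun t ht => ⟨(hu N' (hN.trans_le hNN)).2 t
        ⟨by linarith [ht.1], by linarith [ht.2]⟩, mem_univ _⟩) ?_
    rw [(hu N hN).1, (hu N' (hN.trans_le hNN)).1]
  refine ⟨fun t => u (|t - t₀| + 1) t, by simp [(hu 1 one_pos).1], fun t => ?_⟩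
  set N := |t - t₀| + 2
  have hN : 0 < N := by positivity
  have ht : t ∈ Ioo (t₀ - N) (t₀ + N) := by
    have := abs_le.1 (le_refl |t - t₀|)
    constructor <;> simp only [N] <;> linarith [this.1, this.2]
  have hev : (fun s => u (|s - t₀| + 1) s) =ᶠ[𝓝 t] u N := by
    have h1 : ∀ᶠ s in 𝓝 t, |s - t₀| < |t - t₀| + 1 :=
      (by fun_prop : Continuous fun s => |s - t₀|).continuousAt.eventually_lt_const
        (by simp)
    filter_upwards [h1] with s hs
    refine huniq _ _ (by positivity) (by simp only [N]; linarith) ?_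
    have := abs_le.1 (le_refl |s - t₀|)
    constructor <;> linarith [this.1, this.2]
  have h2 := (hu N hN).2 t ht
  rw [← hev.eq_of_nhds] at h2
  exact h2.congr_of_eventuallyEq hev

/-- A `C¹` field coincides on a given ball with a bounded and globally Lipschitz one. -/
lemma exists_lipschitz_truncation [FiniteDimensional ℝ E] {F : E → E}
    (hF : ContDiff ℝ 1 F) (R : ℝ) :
    ∃ (G : E → E) (K : NNReal) (M : ℝ), LipschitzWith K G ∧ (∀ x, ‖G x‖ ≤ M) ∧
      ∀ x, ‖x‖ ≤ R → G x = F x := by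
  have hR : 0 < |R| + 1 := by positivity
  let χ : ContDiffBump (0 : E) := ⟨|R| + 1, |R| + 2, hR, by linarith⟩
  have hs : HasCompactSupport fun x => χ x • F x := χ.hasCompactSupport.smul_right
  have hc : ContDiff ℝ 1 fun x => χ x • F x := χ.contDiff.smul hF
  obtain ⟨K, hK⟩ := ContDiff.lipschitzWith_of_hasCompactSupport hs hc one_ne_zero
  obtain ⟨M, hM⟩ := hs.exists_bound_of_continuous hc.continuous
  refine ⟨_, K, M, hK, hM, fun x hx => ?_⟩
  have : χ x = 1 := χ.one_of_mem_closedBall (by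
    rw [mem_closedBall_zero_iff]
    change ‖x‖ ≤ |R| + 1
    linarith [le_abs_self R])
  simp [this]

end Global

/-! ### The oscillator governing the invariant boundary `T = 1` -/

/-- The restriction of the vector field to `T = 1`. -/
def frozen (n : ℕ) (z : ℝ × ℝ) : ℝ × ℝ := (z.2, -(n : ℝ) * z.1 ^ (2 * n - 1))

/-- The first integral of the oscillator. -/
def energy (n : ℕ) (z : ℝ × ℝ) : ℝ := z.2 ^ 2 + z.1 ^ (2 * n)

lemma contDiff_frozen (n : ℕ) : ContDiff ℝ 1 (frozen n) := by
  unfold frozen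
  fun_prop

lemma continuous_energy (n : ℕ) : Continuous (energy n) := by
  unfold energy
  fun_prop

lemma energy_nonneg (n : ℕ) (z : ℝ × ℝ) : 0 ≤ energy n z :=
  add_nonneg (sq_nonneg _) (by rw [pow_mul]; positivity)

lemma abs_le_one_of_energy_le {n : ℕ} (hn : 0 < n) {z : ℝ × ℝ} (h : energy n z ≤ 1) :
    |z.1| ≤ 1 ∧ |z.2| ≤ 1 := by
  unfold energy at h
  have h1 : 0 ≤ z.1 ^ (2 * n) := by rw [pow_mul]; positivity
  have h2 := sq_nonneg z.2
  refine ⟨?_, abs_le_one_iff_mul_self_le_one.2 (by nlinarith)⟩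
  have h3 : |z.1| ^ (2 * n) ≤ 1 := by
    rw [pow_mul, sq_abs, ← pow_mul]
    linarith
  exact (pow_le_one_iff_of_nonneg (abs_nonneg _) (by omega)).1 h3

lemma norm_le_one_of_energy_le {n : ℕ} (hn : 0 < n) {z : ℝ × ℝ} (h : energy n z ≤ 1) :
    ‖z‖ ≤ 1 := by
  have := abs_le_one_of_energy_le hn h
  exact max_le this.1 this.2

lemma hasDerivAt_energy {n : ℕ} {u : ℝ → ℝ × ℝ} {t : ℝ}
    (h : HasDerivAt u (frozen n (u t)) t) : HasDerivAt (fun t => energy n (u t)) 0 t := by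
  have h1 : HasDerivAt (fun t => (u t).1) (u t).2 t := h.fst
  have h2 : HasDerivAt (fun t => (u t).2) (-(n : ℝ) * (u t).1 ^ (2 * n - 1)) t := h.snd
  refine ((h2.pow 2).add (h1.pow (2 * n))).congr_deriv ?_
  push_cast
  ring

/-- A curve is an orbit on the unit energy level. -/
def IsUnitOrbit (n : ℕ) (u : ℝ → ℝ × ℝ) : Prop :=
  ∀ t, HasDerivAt u (frozen n (u t)) t ∧ energy n (u t) = 1

/-- The truncated field agrees with `frozen` only on the ball of radius 2. Unit energy forces norm
at most 1, which leaves room for a clopen argument: near a time with energy 1 the true equation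
holds and conserves the energy. -/
lemma exists_isUnitOrbit {n : ℕ} (hn : 0 < n) : ∃ u, u 0 = (0, 1) ∧ IsUnitOrbit n u := by
  obtain ⟨G, K, M, hK, hM, hG⟩ := exists_lipschitz_truncation (contDiff_frozen n) 2
  obtain ⟨u, hu0, hu⟩ := exists_global_solution hK hM 0 ((0 : ℝ), (1 : ℝ))
  have huc : Continuous u := continuous_iff_continuousAt.2 fun t => (hu t).continuousAt
  have hE : ∀ t, energy n (u t) = 1 := by
    have hcl : IsClopen {t | energy n (u t) = 1} := by
      refine ⟨isClosed_eq ((continuous_energy n).comp huc) continuous_const, ?_⟩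
      rw [Metric.isOpen_iff]
      intro t ht
      have h1 : ‖u t‖ < 2 := (norm_le_one_of_energy_le hn (le_of_eq ht)).trans_lt one_lt_two
      obtain ⟨δ, hδ, hball⟩ := Metric.eventually_nhds_iff_ball.1
        (huc.norm.continuousAt.eventually_lt_const h1)
      refine ⟨δ, hδ, fun s hs => ?_⟩
      have hd : ∀ r ∈ Metric.ball t δ, HasDerivAt (fun t => energy n (u t)) 0 r := by
        intro r hr
        apply hasDerivAt_energy
        rw [← hG _ (hball r hr).le]
        exact hu r
      have := Metric.isOpen_ball.is_const_of_deriv_eq_zero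
        (convex_ball t δ).isPreconnected
        (fun r hr => (hd r hr).differentiableAt.differentiableWithinAt)
        (fun r hr => (hd r hr).deriv) hs (Metric.mem_ball_self hδ)
      exact this.trans ht
    exact fun t => (hcl.eq_univ ⟨0, by simp [hu0, energy, hn.ne']⟩).ge (mem_univ t)
  refine ⟨u, hu0, fun t => ⟨?_, hE t⟩⟩
  rw [← hG _ ((norm_le_one_of_energy_le hn (hE t).le).trans one_le_two)]
  exact hu t

lemma IsUnitOrbit.unique {n : ℕ} (hn : 0 < n) {u w : ℝ → ℝ × ℝ} (hu : IsUnitOrbit n u)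
    (hw : IsUnitOrbit n w) {t₀ : ℝ} (h : u t₀ = w t₀) : u = w := by
  obtain ⟨G, K, M, hK, hM, hG⟩ := exists_lipschitz_truncation (contDiff_frozen n) 2
  have key : ∀ {v}, IsUnitOrbit n v → ∀ t, HasDerivAt v (G (v t)) t := by
    intro v hv t
    rw [hG _ ((norm_le_one_of_energy_le hn (hv t).2.le).trans one_le_two)]
    exact (hv t).1
  exact ODE_solution_unique_univ (v := fun _ => G) (s := fun _ => univ) (K := K)
    (fun t => hK.lipschitzOnWith) (fun t => ⟨key hu t, mem_univ _⟩)
    (fun t => ⟨key hw t, mem_univ _⟩) h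

lemma IsUnitOrbit.fst {n : ℕ} {u : ℝ → ℝ × ℝ} (hu : IsUnitOrbit n u) (t : ℝ) :
    HasDerivAt (fun t => (u t).1) (u t).2 t := (hu t).1.fst

lemma IsUnitOrbit.snd {n : ℕ} {u : ℝ → ℝ × ℝ} (hu : IsUnitOrbit n u) (t : ℝ) :
    HasDerivAt (fun t => (u t).2) (-(n : ℝ) * (u t).1 ^ (2 * n - 1)) t := (hu t).1.snd

lemma neg_pow_two_mul_sub_one {n : ℕ} (hn : 0 < n) (x : ℝ) :
    (-x) ^ (2 * n - 1) = -x ^ (2 * n - 1) :=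
  Odd.neg_pow ⟨n - 1, by omega⟩ x

lemma IsUnitOrbit.neg_shift {n : ℕ} (hn : 0 < n) {u : ℝ → ℝ × ℝ} (hu : IsUnitOrbit n u) (a : ℝ) :
    IsUnitOrbit n (fun t => -u (t + a)) := by
  refine fun t => ⟨?_, ?_⟩
  · refine ((hu (t + a)).1.comp_add_const t a).neg.congr_deriv ?_
    simp [frozen, neg_pow_two_mul_sub_one hn]
  · rw [← (hu (t + a)).2]
    simp [energy]

lemma IsUnitOrbit.reflect {n : ℕ} {u : ℝ → ℝ × ℝ} (hu : IsUnitOrbit n u) (a : ℝ) :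
    IsUnitOrbit n (fun t => ((u (a - t)).1, -(u (a - t)).2)) := by
  refine fun t => ⟨?_, ?_⟩
  · refine (((hu.fst (a - t)).comp_const_sub a t).prodMk
      ((hu.snd (a - t)).comp_const_sub a t).neg).congr_deriv ?_
    simp [frozen]
  · rw [← (hu (a - t)).2]
    simp [energy]

/-- While `Σ > 0`, `X` increases. Were `Σ` positive for ever, `X` would be bounded below by a
positive constant after time 1, so `Σ' ≤ -k < 0` would make `Σ` negative in finite time. -/
lemma IsUnitOrbit.exists_quarter {n : ℕ} (hn : 0 < n) {u : ℝ → ℝ × ℝ} (hu : IsUnitOrbit n u)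
    (h0 : u 0 = (0, 1)) :
    ∃ c, 0 < c ∧ u c = (1, 0) ∧ ∀ t ∈ Icc 0 c, 0 ≤ (u t).1 := by
  have hn' : (0 : ℝ) < n := Nat.cast_pos.2 hn
  have hsc : Continuous fun t => (u t).2 :=
    continuous_iff_continuousAt.2 fun t => (hu.snd t).continuousAt
  have hxc : Continuous fun t => (u t).1 :=
    continuous_iff_continuousAt.2 fun t => (hu.fst t).continuousAt
  have hmono : ∀ a b, a ≤ b → (∀ t ∈ Ioo a b, 0 ≤ (u t).2) → (u a).1 ≤ (u b).1 :=
    fun a b hab h => le_of_hasDerivAt_nonneg hab hxc.continuousOn (fun t _ => hu.fst t) h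
  have hex : ∃ b, 0 ≤ b ∧ ¬ 0 < (u b).2 := by
    by_contra! hpos
    have hx1 : 0 < (u 1).1 := by
      have h1 : 0 ≤ (u 1).1 := by
        simpa [h0] using hmono 0 1 zero_le_one fun t ht => (hpos t ht.1.le).le
      refine lt_of_le_of_ne h1 fun h => ?_
      have hz : ∀ t ∈ Icc (0 : ℝ) 1, (u t).1 = 0 := by
        intro t ht
        have h2 := hmono 0 t ht.1 fun s hs => (hpos s hs.1.le).le
        have h3 := hmono t 1 ht.2 fun s hs => (hpos s (ht.1.trans hs.1.le)).le
        rw [h0] at h2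
        exact le_antisymm (h3.trans h.symm.le) h2
      have h4 : HasDerivAt (fun t => (u t).1) 0 (1 / 2) := by
        refine (hasDerivAt_const (1 / 2 : ℝ) (0 : ℝ)).congr_of_eventuallyEq ?_
        filter_upwards [Icc_mem_nhds (show (0 : ℝ) < 1 / 2 by norm_num)
          (show (1 / 2 : ℝ) < 1 by norm_num)] with t ht using hz t ht
      exact (hpos (1 / 2) (by norm_num)).ne ((hu.fst _).unique h4).symm
    set k := (n : ℝ) * (u 1).1 ^ (2 * n - 1) with hk
    have hkpos : 0 < k := by positivity
    have hdec : ∀ t, 1 ≤ t → (u t).2 + k * t ≤ (u 1).2 + k * 1 := by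
      intro t ht
      have := le_of_hasDerivAt_nonneg (f := fun t => -((u t).2 + k * t)) ht
        (by fun_prop) (fun s _ => ((hu.snd s).add ((hasDerivAt_id s).const_mul k)).neg)
        (fun s hs => by
          have h1 := hmono 1 s hs.1.le fun r hr => (hpos r (by linarith [hr.1])).le
          have h2 : (u 1).1 ^ (2 * n - 1) ≤ (u s).1 ^ (2 * n - 1) :=
            pow_le_pow_left₀ hx1.le h1 _
          have h3 := mul_le_mul_of_nonneg_left h2 hn'.le
          rw [← hk] at h3
          linarith)
      linarith
    have ht1 : 1 ≤ 1 + (u 1).2 / k := by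
      have := div_nonneg (hpos 1 zero_le_one).le hkpos.le
      linarith
    have h1 := hdec _ ht1
    have h2 : k * (1 + (u 1).2 / k) = k + (u 1).2 := by field_simp
    have h3 := hpos (1 + (u 1).2 / k) (zero_le_one.trans ht1)
    rw [h2] at h1
    linarith
  obtain ⟨b, hb0, hb⟩ := hex
  obtain ⟨c, hc0, hc, hlt⟩ := exists_first_exit (u := fun t => (u t).2) isOpen_Ioi
    hsc.continuousOn (by simp [h0]) hb0 hb
  have hsc0 : (u c).2 = 0 := by
    refine le_antisymm (not_lt.1 hc) ?_
    have h1 : Tendsto (fun t => (u t).2) (𝓝[<] c) (𝓝 (u c).2) :=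
      hsc.continuousAt.tendsto.mono_left nhdsWithin_le_nhds
    refine ge_of_tendsto h1 ?_
    filter_upwards [Ico_mem_nhdsLT hc0] with t ht using (hlt t ht).le
  have hx : ∀ t ∈ Icc 0 c, 0 ≤ (u t).1 := by
    intro t ht
    simpa [h0] using hmono 0 t ht.1 fun s hs => (hlt s ⟨hs.1.le, hs.2.trans_le ht.2⟩).le
  refine ⟨c, hc0, ?_, hx⟩
  have hE := (hu c).2
  simp only [energy, hsc0] at hE
  have h1 : (u c).1 = 1 := by
    refine (pow_eq_one_iff_of_nonneg (hx c ⟨hc0.le, le_rfl⟩) (n := 2 * n) (by omega)).1 ?_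
    linarith
  exact Prod.ext h1 hsc0

/-- The unit energy level is a periodic orbit of the oscillator. -/
lemma exists_periodic_unitOrbit {n : ℕ} (hn : 0 < n) : ∃ (u : ℝ → ℝ × ℝ) (L : ℝ), 0 < L ∧
    IsUnitOrbit n u ∧ Function.Periodic u L ∧ ∀ z, energy n z = 1 → ∃ t, u t = z := by
  obtain ⟨u, h0, hu⟩ := exists_isUnitOrbit hn
  obtain ⟨c, hc, huc, hx⟩ := hu.exists_quarter hn h0
  have hsc : Continuous fun t => (u t).2 :=
    continuous_iff_continuousAt.2 fun t => (hu.snd t).continuousAt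
  -- Time reversal about the turning point `c`, where `Σ = 0`. At `t = 0` it gives `u (2c) = -u 0`;
  -- oddness of the field then gives half-period antisymmetry, hence the period `4c`.
  have hrefl : ∀ t, u t = ((u (2 * c - t)).1, -(u (2 * c - t)).2) := by
    have := hu.unique hn (hu.reflect (2 * c)) (t₀ := c) (by
      rw [show 2 * c - c = c by ring, huc]
      simp)
    exact fun t => congrFun this t
  have hneg : ∀ t, u t = -u (t + 2 * c) := by
    have := hu.unique hn (hu.neg_shift hn (2 * c)) (t₀ := 0) (by
      have := hrefl 0
      rw [sub_zero, h0] at this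
      have h1 := congrArg Prod.fst this
      have h2 := congrArg Prod.snd this
      simp only at h1 h2
      rw [zero_add, h0]
      ext
      · simp [← h1]
      · simpa using h2)
    exact fun t => congrFun this t
  have hfirst : ∀ z : ℝ × ℝ, energy n z = 1 → 0 ≤ z.1 → 0 ≤ z.2 → ∃ t, u t = z := by
    intro z hz h1 h2
    have h3 : z.2 ≤ 1 := (le_abs_self _).trans (abs_le_one_of_energy_le hn hz.le).2
    obtain ⟨t, ht, hts⟩ := intermediate_value_Icc' hc.le hsc.continuousOn
      (show z.2 ∈ Icc (u c).2 (u 0).2 by rw [huc, h0]; exact ⟨h2, h3⟩)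
    refine ⟨t, Prod.ext ?_ hts⟩
    have h4 := (hu t).2.trans hz.symm
    simp only at hts
    simp only [energy, hts, add_right_inj] at h4
    exact (pow_left_inj₀ (hx t ht) h1 (by omega)).1 h4
  have hright : ∀ z : ℝ × ℝ, energy n z = 1 → 0 ≤ z.1 → ∃ t, u t = z := by
    intro z hz h1
    rcases le_total 0 z.2 with h2 | h2
    · exact hfirst z hz h1 h2
    · obtain ⟨t, ht⟩ := hfirst (z.1, -z.2) (by rw [← hz]; simp [energy]) h1 (by simpa using h2)
      refine ⟨2 * c - t, ?_⟩
      rw [hrefl, show 2 * c - (2 * c - t) = t by ring, ht]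
      simp
  refine ⟨u, 4 * c, by positivity, hu, fun t => ?_, fun z hz => ?_⟩
  · rw [hneg t, hneg (t + 2 * c), neg_neg]
    congr 1
    ring
  · rcases le_total 0 z.1 with h1 | h1
    · exact hright z hz h1
    · obtain ⟨t, ht⟩ := hright (-z) (by rw [← hz]; simp [energy]) (by simpa using h1)
      exact ⟨t + 2 * c, by rw [← neg_inj, ← hneg, ht]⟩

/-- Every positive energy level is a periodic orbit, and the time average of `X ^ n Σ ^ 2` along it
scales like the power `3 / 2` of the energy. -/
lemma exists_periodic_orbits {n p : ℕ} (hn : 0 < n) (hp : n = 2 * p) : ∃ K : ℝ, 0 < K ∧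
    ∀ c : ℝ, 0 < c → ∃ (v : ℝ → ℝ × ℝ) (L : ℝ), 0 < L ∧
      (∀ t, HasDerivAt v (frozen n (v t)) t) ∧ (∀ t, energy n (v t) = c) ∧
      Function.Periodic v L ∧ (∀ z, energy n z = c → ∃ t, v t = z) ∧
      ∫ t in (0 : ℝ)..L, (v t).1 ^ n * (v t).2 ^ 2 = L * (K * (c * √c)) := by
  obtain ⟨u, P, hP, hu, hper, hsurj⟩ := exists_periodic_unitOrbit hn
  have hroot : ∀ c : ℝ, 0 < c → ∃ a : ℝ, 0 < a ∧ a ^ (2 * n) = c := fun c hc =>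
    ⟨c ^ (((2 * n : ℕ) : ℝ)⁻¹), by positivity, Real.rpow_inv_natCast_pow hc.le (by omega)⟩
  have huc : Continuous u := continuous_iff_continuousAt.2 fun t => (hu t).1.continuousAt
  have hI : 0 < ∫ t in (0 : ℝ)..P, (u t).1 ^ n * (u t).2 ^ 2 := by
    apply intervalIntegral.integral_pos hP
    · fun_prop
    · intro t _
      rw [hp, pow_mul]
      positivity
    · obtain ⟨a, ha, han⟩ := hroot (1 / 2) (by norm_num)
      obtain ⟨t, ht⟩ := hsurj (a, √(1 / 2)) (by
        simp only [energy, han]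
        rw [Real.sq_sqrt (by norm_num)]
        norm_num)
      obtain ⟨s, hs, hst⟩ := hper.exists_mem_Ico₀ hP t
      refine ⟨s, Ico_subset_Icc_self hs, ?_⟩
      rw [← hst, ht]
      positivity
  refine ⟨(∫ t in (0 : ℝ)..P, (u t).1 ^ n * (u t).2 ^ 2) / P, div_pos hI hP, fun c hc => ?_⟩
  obtain ⟨a, ha, hac⟩ := hroot c hc
  set b := √c
  have hb : 0 < b := Real.sqrt_pos.2 hc
  have hb2 : b ^ 2 = c := Real.sq_sqrt hc.le
  have han : a ^ n = b := by
    rw [← Real.sqrt_sq (show 0 ≤ a ^ n by positivity), ← pow_mul, mul_comm n 2, hac]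
  -- Amplitudes `a`, `b` with `a^(2n) = b² = c` put the rescaled orbit on level `c`; `X' = Σ` forces
  -- the frequency `b / a`. The mean of `X^n Σ²` is multiplied by `a^n b² = c√c`.
  set k := b / a
  have hk : 0 < k := div_pos hb ha
  have hak : a * k = b := by simp only [k]; field_simp
  have hpow : a ^ (2 * n - 1) = b * k := by
    have h1 : a ^ (2 * n - 1) * a = b * b := by
      rw [← pow_succ, show 2 * n - 1 + 1 = 2 * n by omega, hac, ← hb2, sq]
    simp only [k]
    field_simp
    linarith
  have hd1 : ∀ t, HasDerivAt (fun t => a * (u (k * t)).1) (a * (k * (u (k * t)).2)) t := fun t => by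
    have := ((hu.fst (k * t)).scomp t ((hasDerivAt_id t).const_mul k)).const_mul a
    simpa using this
  have hd2 : ∀ t, HasDerivAt (fun t => b * (u (k * t)).2)
      (b * (k * (-(n : ℝ) * (u (k * t)).1 ^ (2 * n - 1)))) t := fun t => by
    have := ((hu.snd (k * t)).scomp t ((hasDerivAt_id t).const_mul k)).const_mul b
    simpa using this
  refine ⟨fun t => (a * (u (k * t)).1, b * (u (k * t)).2), P / k, div_pos hP hk, fun t => ?_,
    fun t => ?_, fun t => ?_, fun z hz => ?_, ?_⟩
  · refine ((hd1 t).prodMk (hd2 t)).congr_deriv (Prod.ext ?_ ?_)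
    · simp only [frozen]
      rw [← mul_assoc, hak]
    · simp only [frozen]
      rw [mul_pow, hpow]
      ring
  · have := (hu (k * t)).2
    simp only [energy] at this ⊢
    rw [mul_pow, mul_pow, hac, hb2, ← mul_add, this, mul_one]
  · have : k * (t + P / k) = k * t + P := by field_simp
    simp only [this, hper (k * t)]
  · obtain ⟨t, ht⟩ := hsurj (z.1 / a, z.2 / b) (by
      simp only [energy] at hz ⊢
      rw [div_pow, div_pow, hac, hb2, ← add_div, hz, div_self hc.ne'])
    refine ⟨t / k, ?_⟩
    simp only [show k * (t / k) = t by field_simp, ht]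
    exact Prod.ext (by field_simp) (by field_simp)
  · have h1 : ∀ t, (a * (u (k * t)).1) ^ n * (b * (u (k * t)).2) ^ 2
        = c * b * ((fun s => (u s).1 ^ n * (u s).2 ^ 2) (k * t)) := by
      intro t
      simp only [mul_pow, han, hb2]
      ring
    simp only [h1]
    rw [intervalIntegral.integral_const_mul,
      intervalIntegral.integral_comp_mul_left (fun s => (u s).1 ^ n * (u s).2 ^ 2) hk.ne',
      mul_zero, mul_div_cancel₀ _ hk.ne', smul_eq_mul]
    field_simp

/-! ### Averages along the oscillator and correctors -/

/-- The function `f` differs from the function `m` of the energy by the derivative of a `C¹`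
function along the oscillator. -/
def HasMean (n : ℕ) (f : ℝ × ℝ → ℝ) (m : ℝ → ℝ) : Prop :=
  ∃ B : ℝ × ℝ → ℝ, ContDiff ℝ 1 B ∧
    ∀ z, fderiv ℝ B z (frozen n z) = f z - m (energy n z)

lemma HasMean.congr {n : ℕ} {f g : ℝ × ℝ → ℝ} {m k : ℝ → ℝ} (h : HasMean n f m)
    (hfg : ∀ z, g z - k (energy n z) = f z - m (energy n z)) : HasMean n g k := by
  obtain ⟨B, hB, h⟩ := h
  exact ⟨B, hB, fun z => (h z).trans (hfg z).symm⟩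

lemma hasMean_energy (n : ℕ) (m : ℝ → ℝ) : HasMean n (fun z => m (energy n z)) m :=
  ⟨fun _ => 0, contDiff_const, fun z => by simp⟩

lemma HasMean.add {n : ℕ} {f g : ℝ × ℝ → ℝ} {m k : ℝ → ℝ} (hf : HasMean n f m)
    (hg : HasMean n g k) : HasMean n (fun z => f z + g z) (fun E => m E + k E) := by
  obtain ⟨B, hB, h⟩ := hf
  obtain ⟨C, hC, h'⟩ := hg
  refine ⟨fun z => B z + C z, hB.add hC, fun z => ?_⟩
  rw [fderiv_fun_add (hB.differentiable one_ne_zero z) (hC.differentiable one_ne_zero z),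
    _root_.add_apply, h, h']
  ring

lemma contDiff_energy (n : ℕ) : ContDiff ℝ 1 (energy n) := by
  unfold energy
  fun_prop

lemma fderiv_energy_frozen (n : ℕ) (z : ℝ × ℝ) : fderiv ℝ (energy n) z (frozen n z) = 0 := by
  have h1 : HasFDerivAt (fun z : ℝ × ℝ => z.1) (ContinuousLinearMap.fst ℝ ℝ ℝ) z := hasFDerivAt_fst
  have h2 : HasFDerivAt (fun z : ℝ × ℝ => z.2) (ContinuousLinearMap.snd ℝ ℝ ℝ) z := hasFDerivAt_snd
  have : HasFDerivAt (energy n) _ z := (h2.pow 2).add (h1.pow (2 * n))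
  rw [this.fderiv]
  simp [frozen]
  ring

/-- Functions of the energy are constants for the derivation along the oscillator, so the corrector
is simply multiplied by `φ`. -/
lemma HasMean.energy_mul {n : ℕ} {f : ℝ × ℝ → ℝ} {m φ : ℝ → ℝ} (hf : HasMean n f m)
    (hφ : ContDiff ℝ 1 φ) :
    HasMean n (fun z => φ (energy n z) * f z) (fun E => φ E * m E) := by
  obtain ⟨B, hB, h⟩ := hf
  have hφE : ContDiff ℝ 1 fun z => φ (energy n z) := hφ.comp (contDiff_energy n)
  refine ⟨fun z => φ (energy n z) * B z, hφE.mul hB, fun z => ?_⟩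
  have h1 : fderiv ℝ (fun z => φ (energy n z)) z (frozen n z) = 0 := by
    have := fderiv_comp z (hφ.differentiable one_ne_zero (energy n z))
      ((contDiff_energy n).differentiable one_ne_zero z)
    change fderiv ℝ (φ ∘ energy n) z (frozen n z) = 0
    rw [this, ContinuousLinearMap.comp_apply, fderiv_energy_frozen, map_zero]
  rw [fderiv_fun_mul (hφE.differentiable one_ne_zero z) (hB.differentiable one_ne_zero z)]
  simp only [_root_.add_apply, _root_.smul_apply, h, h1, smul_eq_mul]
  ring

lemma HasMean.const_mul {n : ℕ} {f : ℝ × ℝ → ℝ} {m : ℝ → ℝ} (hf : HasMean n f m) (c : ℝ) :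
    HasMean n (fun z => c * f z) (fun E => c * m E) :=
  hf.energy_mul (φ := fun _ => c) contDiff_const

/-- Virial identity: the derivative of `X ^ (2 n k + 1) Σ` along the oscillator. -/
lemma hasMean_virial {n : ℕ} (hn : 0 < n) (k : ℕ) :
    HasMean n (fun z => (2 * n * k + 1) * energy n z * (z.1 ^ (2 * n)) ^ k
      - (2 * n * k + 1 + n) * (z.1 ^ (2 * n)) ^ (k + 1)) (fun _ => 0) := by
  refine ⟨fun z => z.1 ^ (2 * n * k + 1) * z.2, by fun_prop, fun z => ?_⟩
  have h1 : HasFDerivAt (fun z : ℝ × ℝ => z.1) (ContinuousLinearMap.fst ℝ ℝ ℝ) z := hasFDerivAt_fst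
  have h2 : HasFDerivAt (fun z : ℝ × ℝ => z.2) (ContinuousLinearMap.snd ℝ ℝ ℝ) z := hasFDerivAt_snd
  have : HasFDerivAt (fun z : ℝ × ℝ => z.1 ^ (2 * n * k + 1) * z.2) _ z :=
    (h1.pow (2 * n * k + 1)).mul h2
  rw [this.fderiv]
  obtain ⟨j, rfl⟩ : ∃ j, n = j + 1 := ⟨n - 1, by omega⟩
  simp only [frozen, energy, _root_.add_apply, _root_.smul_apply,
    ContinuousLinearMap.coe_fst', ContinuousLinearMap.coe_snd', smul_eq_mul, nsmul_eq_mul,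
    show 2 * (j + 1) - 1 = 2 * j + 1 by omega, Nat.add_sub_cancel]
  push_cast
  ring

/-- The virial identity expresses the mean of the power `k + 1` through `E` times the mean of the
power `k`. -/
lemma hasMean_pow {n : ℕ} (hn : 0 < n) (k : ℕ) :
    ∃ m, HasMean n (fun z => (z.1 ^ (2 * n)) ^ k) m := by
  induction k with
  | zero => exact ⟨_, by simpa using hasMean_energy n fun _ => 1⟩
  | succ k ih =>
    obtain ⟨m, hm⟩ := ih
    have hpos : (0 : ℝ) < 2 * n * k + 1 + n := by positivity
    refine ⟨fun E => (2 * n * k + 1 + n : ℝ)⁻¹ * ((2 * n * k + 1) * E * m E),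
      (((hm.energy_mul (φ := fun E => (2 * n * k + 1) * E) (by fun_prop)).add
      ((hasMean_virial hn k).const_mul (-1))).const_mul (2 * n * k + 1 + n : ℝ)⁻¹).congr
      fun z => ?_⟩
    field_simp
    ring

/-- The case `k = 0` of the virial identity. The mean of `Σ²` is then `n E / (n + 1)`, which is the
origin of the critical value `2n / (n + 1)` of `γ`. -/
lemma hasMean_pow_two_mul {n : ℕ} (hn : 0 < n) :
    HasMean n (fun z => z.1 ^ (2 * n)) (fun E => E / (n + 1)) := by
  have hpos : (0 : ℝ) < 1 + n := by positivity
  refine (((hasMean_energy n fun E => E).add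
    ((hasMean_virial hn 0).const_mul (-1))).const_mul (1 + n : ℝ)⁻¹).congr fun z => ?_
  have : (n : ℝ) + 1 ≠ 0 := by positivity
  push_cast
  field_simp
  ring

lemma hasMean_polynomial {n : ℕ} (hn : 0 < n) (P : Polynomial ℝ) :
    ∃ m, HasMean n (fun z => P.eval (z.1 ^ (2 * n))) m := by
  induction P using Polynomial.induction_on' with
  | add P Q hP hQ =>
    obtain ⟨m, hm⟩ := hP
    obtain ⟨k, hk⟩ := hQ
    exact ⟨_, by simpa using hm.add hk⟩
  | monomial k a =>
    obtain ⟨m, hm⟩ := hasMean_pow hn k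
    exact ⟨_, by simpa using hm.const_mul a⟩

/-- The derivative of the corrector integrates to zero over a period; this identifies `m c` with the
time average. -/
lemma HasMean.integral_eq {n : ℕ} {f : ℝ × ℝ → ℝ} {m : ℝ → ℝ} (h : HasMean n f m)
    (hf : Continuous f) {v : ℝ → ℝ × ℝ} {L c : ℝ} (hv : ∀ t, HasDerivAt v (frozen n (v t)) t)
    (hE : ∀ t, energy n (v t) = c) (hL : Function.Periodic v L) :
    ∫ t in (0 : ℝ)..L, f (v t) = L * m c := by
  obtain ⟨B, hB, h⟩ := h
  have hvc : Continuous v := continuous_iff_continuousAt.2 fun t => (hv t).continuousAt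
  have hd : ∀ t, HasDerivAt (fun t => B (v t)) (f (v t) - m c) t := fun t => by
    have := ((hB.differentiable one_ne_zero (v t)).hasFDerivAt).comp_hasDerivAt t (hv t)
    rwa [h, hE] at this
  have hint : IntervalIntegrable (fun t => f (v t)) MeasureTheory.volume 0 L :=
    (hf.comp hvc).intervalIntegrable _ _
  have := intervalIntegral.integral_eq_sub_of_hasDerivAt (a := 0) (b := L) (fun t _ => hd t)
    (hint.sub intervalIntegrable_const)
  rw [intervalIntegral.integral_sub hint intervalIntegrable_const,
    intervalIntegral.integral_const, show v L = v 0 by simpa using hL 0] at this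
  simp only [sub_zero, sub_self, smul_eq_mul] at this
  linarith

/-- The slow derivative of the energy, divided by the small parameter. -/
def slowRate (n : ℕ) (γ ν : ℝ) (z : ℝ × ℝ) : ℝ :=
  (1 - energy n z) * (3 * γ * energy n z - 6 * z.2 ^ 2) - 2 * ν * z.1 ^ n * z.2 ^ 2

/-- The average of `slowRate` over an energy level. -/
def meanRate (n : ℕ) (γ ν K E : ℝ) : ℝ :=
  3 * E * (1 - E) * (γ - 2 * n / (n + 1)) - 2 * ν * K * (E * √E)

/-- Averages of `X ^ n Σ ^ 2` are exact up to a `C¹` corrector and an arbitrarily small error. -/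
lemma exists_damping_corrector {n p : ℕ} (hn : 0 < n) (hp : n = 2 * p) : ∃ K : ℝ, 0 < K ∧
    (∀ c : ℝ, 0 < c → ∃ (v : ℝ → ℝ × ℝ) (L : ℝ), 0 < L ∧
      (∀ t, HasDerivAt v (frozen n (v t)) t) ∧ (∀ t, energy n (v t) = c) ∧
      Function.Periodic v L ∧ (∀ z, energy n z = c → ∃ t, v t = z)) ∧
    ∀ δ : ℝ, 0 < δ → ∃ (f : ℝ × ℝ → ℝ) (m : ℝ → ℝ), HasMean n f m ∧
      (∀ z, energy n z ≤ 1 → |f z - z.1 ^ n * z.2 ^ 2| ≤ δ) ∧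
      ∀ E ∈ Icc (0 : ℝ) 1, |m E - K * (E * √E)| ≤ δ := by
  obtain ⟨K, hK, horb⟩ := exists_periodic_orbits hn hp
  refine ⟨K, hK, fun c hc => ?_, fun δ hδ => ?_⟩
  · obtain ⟨v, L, hL, h1, h2, h3, h4, -⟩ := horb c hc
    exact ⟨v, L, hL, h1, h2, h3, h4⟩
  -- Since `n` is even, `X^n = √(X^(2n))`. With `P` close to the square root, `P(X^(2n)) Σ² = (E -
  -- X^(2n)) P(X^(2n))` is a combination of functions with known correctors.
  obtain ⟨P, hP⟩ := exists_polynomial_near_of_continuousOn 0 1 Real.sqrt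
    Real.continuous_sqrt.continuousOn δ hδ
  obtain ⟨m₁, hm₁⟩ := hasMean_polynomial hn P
  obtain ⟨m₂, hm₂⟩ := hasMean_polynomial hn (P * Polynomial.X)
  have hmean := (hm₁.energy_mul (φ := fun E => E) contDiff_id).add (hm₂.const_mul (-1))
  set f : ℝ × ℝ → ℝ := fun z => energy n z * P.eval (z.1 ^ (2 * n))
    + -1 * (P * Polynomial.X).eval (z.1 ^ (2 * n)) with hf
  set m : ℝ → ℝ := fun E => E * m₁ E + -1 * m₂ E with hm
  have hfeq : ∀ z, f z = P.eval (z.1 ^ (2 * n)) * z.2 ^ 2 := fun z => by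
    simp only [hf, energy, Polynomial.eval_mul, Polynomial.eval_X]
    ring
  have hfc : Continuous f := by
    have : f = fun z => P.eval (z.1 ^ (2 * n)) * z.2 ^ 2 := funext hfeq
    rw [this]
    fun_prop
  have herr : ∀ z, energy n z ≤ 1 → |f z - z.1 ^ n * z.2 ^ 2| ≤ δ := by
    intro z hz
    have h1 : 0 ≤ z.1 ^ (2 * n) := by rw [pow_mul]; positivity
    have h2 : z.1 ^ (2 * n) ≤ 1 := by
      simp only [energy] at hz
      nlinarith [sq_nonneg z.2]
    have h3 : z.2 ^ 2 ≤ 1 := by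
      simp only [energy] at hz
      linarith
    have h4 : √(z.1 ^ (2 * n)) = z.1 ^ n := by
      rw [mul_comm, pow_mul, Real.sqrt_sq]
      rw [hp, pow_mul]
      positivity
    have h5 := hP _ ⟨h1, h2⟩
    rw [h4] at h5
    rw [hfeq, ← sub_mul, abs_mul, abs_of_nonneg (sq_nonneg z.2)]
    exact (mul_le_mul h5.le h3 (sq_nonneg _) hδ.le).trans (mul_one δ).le
  refine ⟨f, m, hmean, herr, fun E hE => ?_⟩
  -- At `E = 0` there is no periodic orbit, but the corrector equation at the rest point gives `m 0
  -- = f 0 = 0`.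
  rcases hE.1.eq_or_lt with rfl | hpos
  · obtain ⟨B, -, hB⟩ := hmean
    have h1 : energy n (0 : ℝ × ℝ) = 0 := by simp [energy, hn.ne']
    have h2 : frozen n (0 : ℝ × ℝ) = 0 := by
      simp [frozen, show 2 * n - 1 ≠ 0 by omega]
    have h3 := hB 0
    rw [h2, h1, hfeq, map_zero] at h3
    simp only [Prod.snd_zero] at h3
    have : m 0 = 0 := by linarith
    simp [this, hδ.le]
  · obtain ⟨v, L, hL, h1, h2, h3, -, h5⟩ := horb E hpos
    have hvc : Continuous v := continuous_iff_continuousAt.2 fun t => (h1 t).continuousAt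
    have h6 := hmean.integral_eq hfc h1 h2 h3
    have h7 := intervalIntegral.norm_integral_le_of_norm_le_const (a := 0) (b := L) (C := δ)
      (f := fun t => f (v t) - (v t).1 ^ n * (v t).2 ^ 2)
      (fun t _ => herr (v t) ((h2 t).le.trans hE.2))
    have h8 : Continuous fun t => f (v t) := hfc.comp hvc
    have h9 : Continuous fun t => (v t).1 ^ n * (v t).2 ^ 2 := by fun_prop
    rw [intervalIntegral.integral_sub (h8.intervalIntegrable _ _) (h9.intervalIntegrable _ _), h6, h5, ← mul_sub, Real.norm_eq_abs,
      abs_mul, sub_zero, abs_of_pos hL, mul_comm δ] at h7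
    exact le_of_mul_le_mul_left h7 hL

lemma HasMean.exists_corrector {n : ℕ} (hn : 0 < n) {γ ν K δ : ℝ} (hν : 0 < ν)
    {f : ℝ × ℝ → ℝ} {m : ℝ → ℝ} (h : HasMean n f m)
    (hf : ∀ z, energy n z ≤ 1 → |f z - z.1 ^ n * z.2 ^ 2| ≤ δ)
    (hm : ∀ E ∈ Icc (0 : ℝ) 1, |m E - K * (E * √E)| ≤ δ) :
    ∃ B : ℝ × ℝ → ℝ, ContDiff ℝ 1 B ∧ ∀ z, energy n z ≤ 1 →
      |slowRate n γ ν z - fderiv ℝ B z (frozen n z) - meanRate n γ ν K (energy n z)|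
        ≤ 4 * ν * δ := by
  have hn1 : (n : ℝ) + 1 ≠ 0 := by positivity
  -- This uses `slowRate = 6(1-E) X^(2n) + (1-E)(3γ-6)E - 2ν X^n Σ²`, obtained by eliminating `Σ² =
  -- E - X^(2n)`.
  have h1 := (((hasMean_pow_two_mul hn).energy_mul (φ := fun E => 6 * (1 - E))
    (by fun_prop)).add (hasMean_energy n fun E => (1 - E) * (3 * γ - 6) * E)).add
    (h.const_mul (-2 * ν))
  obtain ⟨B, hB, hBeq⟩ := h1
  refine ⟨B, hB, fun z hz => ?_⟩
  have h2 := abs_le.1 (hf z hz)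
  have h3 := abs_le.1 (hm _ ⟨energy_nonneg n z, hz⟩)
  have hs : z.2 ^ 2 = energy n z - z.1 ^ (2 * n) := by simp [energy]
  have heq : slowRate n γ ν z - fderiv ℝ B z (frozen n z) - meanRate n γ ν K (energy n z)
      = 2 * ν * (f z - z.1 ^ n * z.2 ^ 2)
        - 2 * ν * (m (energy n z) - K * (energy n z * √(energy n z))) := by
    rw [hBeq]
    simp only [slowRate, meanRate]
    rw [show (1 - energy n z) * (3 * γ * energy n z - 6 * z.2 ^ 2)
      = (1 - energy n z) * (3 * γ * energy n z - 6 * (energy n z - z.1 ^ (2 * n))) by rw [hs]]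
    field_simp
    ring
  rw [heq, abs_le]
  constructor <;> nlinarith

/-! ### Solutions in the state space -/

variable {n : ℕ} {γ ν : ℝ}

lemma isOpen_stateSpace (n : ℕ) : IsOpen (stateSpace n) := by
  have h : Continuous (omegaPhi n) := by unfold omegaPhi; fun_prop
  have hT : Continuous fun x : State => x.2.2 := by fun_prop
  exact (isOpen_lt continuous_const h).inter ((isOpen_lt h continuous_const).inter
    ((isOpen_lt continuous_const hT).inter (isOpen_lt hT continuous_const)))

lemma contDiff_field (n : ℕ) (γ ν : ℝ) : ContDiff ℝ 1 (field n γ ν) := by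
  unfold field decel omegaPf omegaPhi
  fun_prop

/-- The projection to the `(X, Σ)` plane. -/
def proj (x : State) : ℝ × ℝ := (x.1, x.2.1)

lemma omegaPhi_eq_energy (n : ℕ) (x : State) : omegaPhi n x = energy n (proj x) := rfl

lemma abs_le_one_of_mem (hn : 0 < n) {x : State} (hx : x ∈ stateSpace n) :
    |x.1| ≤ 1 ∧ |x.2.1| ≤ 1 :=
  abs_le_one_of_energy_le (z := proj x) hn hx.2.1.le

lemma norm_le_one_of_mem (hn : 0 < n) {x : State} (hx : x ∈ stateSpace n) : ‖x‖ ≤ 1 := by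
  have h := abs_le_one_of_mem hn hx
  have h3 : |x.2.2| ≤ 1 := abs_le.2 ⟨by linarith [hx.2.2.1], hx.2.2.2.le⟩
  exact max_le h.1 (max_le h.2 h3)

lemma sq_le_omegaPhi (n : ℕ) (x : State) : x.2.1 ^ 2 ≤ omegaPhi n x :=
  le_add_of_nonneg_right (by rw [pow_mul]; positivity)

lemma pow_mem_of_mem {p : ℕ} (hn : 0 < n) (hp : n = 2 * p) {x : State} (hx : x ∈ stateSpace n) :
    0 ≤ x.1 ^ n ∧ x.1 ^ n ≤ 1 := by
  refine ⟨by rw [hp, pow_mul]; positivity, ?_⟩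
  calc x.1 ^ n ≤ |x.1 ^ n| := le_abs_self _
    _ = |x.1| ^ n := abs_pow _ _
    _ ≤ 1 := pow_le_one₀ (abs_nonneg _) (abs_le_one_of_mem hn hx).1

/-- The quantity `1 + q`. -/
def expRate (n : ℕ) (γ : ℝ) (x : State) : ℝ :=
  3 * x.2.1 ^ 2 + 3 / 2 * γ * (1 - omegaPhi n x)

lemma one_add_decel (n : ℕ) (γ : ℝ) (x : State) : 1 + decel n γ x = expRate n γ x := by
  simp only [decel, expRate, omegaPf]
  ring

lemma expRate_bounds (hγ : 0 < γ) {x : State} (hx : x ∈ stateSpace n) :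
    3 * x.2.1 ^ 2 ≤ expRate n γ x ∧ 3 / 2 * γ * (1 - omegaPhi n x) ≤ expRate n γ x ∧
      0 < expRate n γ x ∧ expRate n γ x ≤ 3 + 3 / 2 * γ := by
  have h1 : 0 < 3 / 2 * γ * (1 - omegaPhi n x) := mul_pos (by linarith) (by linarith [hx.2.1])
  have h2 := sq_nonneg x.2.1
  have h3 := sq_le_omegaPhi n x
  have h4 := hx.2.1
  have h5 : 3 / 2 * γ * (1 - omegaPhi n x) ≤ 3 / 2 * γ * 1 :=
    mul_le_mul_of_nonneg_left (by linarith [hx.1]) (by linarith)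
  simp only [expRate]
  refine ⟨?_, ?_, ?_, ?_⟩ <;> linarith

section Derivatives
variable {u : ℝ → State} {t : ℝ}

lemma hasDerivAt_X (h : HasDerivAt u (field n γ ν (u t)) t) :
    HasDerivAt (fun t => (u t).1) (1 / n * expRate n γ (u t) * (1 - (u t).2.2) * (u t).1
      + (u t).2.2 * (u t).2.1) t := by
  rw [← one_add_decel]
  exact h.fst

lemma hasDerivAt_S (h : HasDerivAt u (field n γ ν (u t)) t) :
    HasDerivAt (fun t => (u t).2.1) (-(3 - expRate n γ (u t)) * (1 - (u t).2.2) * (u t).2.1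
      - n * (u t).2.2 * (u t).1 ^ (2 * n - 1) - ν * (1 - (u t).2.2) * (u t).1 ^ n * (u t).2.1) t := by
  have : HasDerivAt (fun t => (u t).2.1) (field n γ ν (u t)).2.1 t := h.snd.fst
  refine this.congr_deriv ?_
  rw [← one_add_decel]
  simp only [field]
  ring

lemma hasDerivAt_T (h : HasDerivAt u (field n γ ν (u t)) t) :
    HasDerivAt (fun t => (u t).2.2) (1 / n * expRate n γ (u t) * (u t).2.2
      * (1 - (u t).2.2) ^ 2) t := by
  rw [← one_add_decel]
  exact h.snd.snd

/-- The contributions `±2nT X^(2n-1) Σ` of the oscillator cancel, so only terms with the factor `1 -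
T` survive. -/
lemma hasDerivAt_omegaPhi (hn : 0 < n) (h : HasDerivAt u (field n γ ν (u t)) t) :
    HasDerivAt (fun t => omegaPhi n (u t))
      ((1 - (u t).2.2) * slowRate n γ ν (proj (u t))) t := by
  have hn' : (n : ℝ) ≠ 0 := Nat.cast_ne_zero.2 hn.ne'
  refine (((hasDerivAt_S h).pow 2).add ((hasDerivAt_X h).pow (2 * n))).congr_deriv ?_
  have h1 : (u t).1 ^ (2 * n) = (u t).1 ^ (2 * n - 1) * (u t).1 := by
    rw [← pow_succ]
    congr 1
    omega
  simp only [slowRate, expRate, energy, proj, omegaPhi, h1]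
  push_cast
  field_simp
  ring

end Derivatives

/-- The state space is forward invariant. -/
lemma mem_stateSpace_of_solution {p : ℕ} (hn : 0 < n) (hp : n = 2 * p) (hγ : 0 < γ) (hν : 0 < ν)
    {u : ℝ → State} {a : ℝ} (hc : ContinuousOn u (Ici a))
    (hd : ∀ t, a < t → u t ∈ stateSpace n → HasDerivAt u (field n γ ν (u t)) t)
    (ha : u a ∈ stateSpace n) {t : ℝ} (hat : a ≤ t) : u t ∈ stateSpace n := by
  by_contra hnot
  obtain ⟨c, hac, hcS, hS⟩ := exists_first_exit (isOpen_stateSpace n) hc ha hat hnot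
  have hn' : (0 : ℝ) < n := Nat.cast_pos.2 hn
  have hcc : ContinuousOn u (Icc a c) := hc.mono Icc_subset_Ici_self
  have hmem : ∀ s ∈ Ioo a c, u s ∈ stateSpace n := fun s hs => hS s ⟨hs.1.le, hs.2⟩
  have hder : ∀ s ∈ Ioo a c, HasDerivAt u (field n γ ν (u s)) s := fun s hs =>
    hd s hs.1 (hmem s hs)
  have hΩc : ContinuousOn (fun s => omegaPhi n (u s)) (Icc a c) := by
    unfold omegaPhi
    fun_prop
  -- Before the exit time `c` each of the four quantities `f` defining the state space satisfies `f'
  -- ≥ -C f`, hence is still positive at `c`.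
  refine hcS ⟨?_, ?_, ?_, ?_⟩
  · refine pos_of_deriv_ge_neg_mul (f := fun s => omegaPhi n (u s)) (C := 6 + 2 * ν) hac.le hΩc
      (fun s hs => hasDerivAt_omegaPhi hn (hder s hs)) (fun s hs => ?_) ha.1
    have hx := hmem s hs
    have h1 := pow_mem_of_mem hn hp hx
    have h2 := sq_le_omegaPhi n (u s)
    have h3 := sq_nonneg (u s).2.1
    obtain ⟨h4, h5, h6, h7⟩ := hx
    have h8 : -(6 + 2 * ν) * omegaPhi n (u s) ≤ slowRate n γ ν (proj (u s)) := by
      simp only [slowRate, ← omegaPhi_eq_energy]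
      simp only [proj]
      have e1 : 0 ≤ (1 - omegaPhi n (u s)) * (3 * γ * omegaPhi n (u s)) := by
        apply mul_nonneg (by linarith) (by positivity)
      have e2 : (1 - omegaPhi n (u s)) * (u s).2.1 ^ 2 ≤ 1 * omegaPhi n (u s) :=
        mul_le_mul (by linarith) h2 h3 zero_le_one
      have e3 : (u s).1 ^ n * (u s).2.1 ^ 2 ≤ 1 * omegaPhi n (u s) :=
        mul_le_mul h1.2 h2 h3 zero_le_one
      have e4 := mul_le_mul_of_nonneg_left e3 hν.le
      nlinarith
    have h9 : -(6 + 2 * ν) * omegaPhi n (u s) ≤ 0 := by nlinarith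
    nlinarith
  · have := pos_of_deriv_ge_neg_mul (f := fun s => 1 - omegaPhi n (u s)) (C := 3 * γ) hac.le
      (continuousOn_const.sub hΩc)
      (fun s hs => (hasDerivAt_omegaPhi hn (hder s hs)).const_sub 1) (fun s hs => ?_)
      (by linarith [ha.2.1])
    · linarith
    have hx := hmem s hs
    have h1 := pow_mem_of_mem hn hp hx
    have h3 := sq_nonneg (u s).2.1
    obtain ⟨h4, h5, h6, h7⟩ := hx
    have h8 : slowRate n γ ν (proj (u s)) ≤ 3 * γ * (1 - omegaPhi n (u s)) := by
      simp only [slowRate, ← omegaPhi_eq_energy]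
      simp only [proj]
      have e1 : (1 - omegaPhi n (u s)) * (3 * γ * omegaPhi n (u s))
          ≤ (1 - omegaPhi n (u s)) * (3 * γ * 1) := by
        apply mul_le_mul_of_nonneg_left _ (by linarith)
        apply mul_le_mul_of_nonneg_left h5.le (by positivity)
      have e2 : 0 ≤ (1 - omegaPhi n (u s)) * (u s).2.1 ^ 2 := mul_nonneg (by linarith) h3
      have e3 : 0 ≤ 2 * ν * (u s).1 ^ n * (u s).2.1 ^ 2 := by
        have := h1.1
        positivity
      linarith
    have h9 : 0 ≤ 3 * γ * (1 - omegaPhi n (u s)) := mul_nonneg (by linarith) (by linarith)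
    nlinarith
  · refine pos_of_deriv_ge_neg_mul (C := 0) hac.le (by fun_prop)
      (fun s hs => hasDerivAt_T (hder s hs)) (fun s hs => ?_) ha.2.2.1
    have hx := hmem s hs
    have h1 := (expRate_bounds hγ hx).2.2.1
    have h2 := hx.2.2.1
    simp only [neg_zero, zero_mul]
    positivity
  · have := pos_of_deriv_ge_neg_mul (f := fun s => 1 - (u s).2.2) (C := 1 / n * (3 + 3 / 2 * γ))
      hac.le (by fun_prop) (fun s hs => (hasDerivAt_T (hder s hs)).const_sub 1) (fun s hs => ?_)
      (by linarith [ha.2.2.2])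
    · linarith
    have hx := hmem s hs
    have h1 := expRate_bounds hγ hx
    have h2 := hx.2.2.1
    have h3 := hx.2.2.2
    have h4 : (u s).2.2 * (1 - (u s).2.2) ^ 2 ≤ 1 - (u s).2.2 := by nlinarith
    have h5 : 1 / (n : ℝ) * expRate n γ (u s) ≤ 1 / n * (3 + 3 / 2 * γ) :=
      mul_le_mul_of_nonneg_left h1.2.2.2 (by positivity)
    have h6 := mul_le_mul h5 h4 (by positivity) (by positivity)
    linarith

/-- A solution that stays in the state space from time `a` on. -/
def IsOrbit (n : ℕ) (γ ν a : ℝ) (u : ℝ → State) : Prop :=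
  ∀ t, a ≤ t → HasDerivAt u (field n γ ν (u t)) t ∧ u t ∈ stateSpace n

lemma exists_solution {p : ℕ} (hn : 0 < n) (hp : n = 2 * p) (hγ : 0 < γ) (hν : 0 < ν) (τ₀ : ℝ)
    {x₀ : State} (hx₀ : x₀ ∈ stateSpace n) : ∃ u : ℝ → State, u τ₀ = x₀ ∧
      IsForwardSolution (field n γ ν) τ₀ u ∧ ∀ τ, τ₀ ≤ τ → u τ ∈ stateSpace n := by
  obtain ⟨G, K, M, hK, hM, hG⟩ := exists_lipschitz_truncation (contDiff_field n γ ν) 1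
  obtain ⟨u, hu0, hu⟩ := exists_global_solution hK hM τ₀ x₀
  have hder : ∀ t, u t ∈ stateSpace n → HasDerivAt u (field n γ ν (u t)) t := fun t ht => by
    rw [← hG _ (norm_le_one_of_mem hn ht)]
    exact hu t
  have hmem : ∀ τ, τ₀ ≤ τ → u τ ∈ stateSpace n := fun τ hτ =>
    mem_stateSpace_of_solution hn hp hγ hν
      (fun t _ => (hu t).continuousAt.continuousWithinAt) (fun t _ => hder t) (by rwa [hu0]) hτ
  exact ⟨u, hu0, fun t ht => (hder t (hmem t ht)).hasDerivWithinAt, hmem⟩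

/-- Only a one-sided derivative is given at `τ₀`; starting one unit later makes all derivatives
two-sided, without affecting the asymptotics. -/
lemma IsForwardSolution.isOrbit {p : ℕ} (hn : 0 < n) (hp : n = 2 * p) (hγ : 0 < γ) (hν : 0 < ν)
    {τ₀ : ℝ} {u : ℝ → State} (hu : IsForwardSolution (field n γ ν) τ₀ u)
    (h0 : u τ₀ ∈ stateSpace n) : IsOrbit n γ ν (τ₀ + 1) u := by
  have hder : ∀ t, τ₀ < t → HasDerivAt u (field n γ ν (u t)) t := fun t ht =>
    (hu t ht.le).hasDerivAt (Ici_mem_nhds ht)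
  exact fun t ht => ⟨hder t (by linarith), mem_stateSpace_of_solution hn hp hγ hν
    (fun s hs => ((hu s hs).continuousWithinAt)) (fun s hs _ => hder s hs) h0 (by linarith)⟩

/-! ### Convergence of `T` to `1` -/

/-- The slow clock `log (T / (1 - T))`. -/
def clock (x : State) : ℝ := Real.log x.2.2 - Real.log (1 - x.2.2)

lemma hasDerivAt_clock {u : ℝ → State} {t : ℝ} (h : HasDerivAt u (field n γ ν (u t)) t)
    (ht : u t ∈ stateSpace n) :
    HasDerivAt (fun t => clock (u t)) (1 / n * expRate n γ (u t) * (1 - (u t).2.2)) t := by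
  have h1 : (u t).2.2 ≠ 0 := ht.2.2.1.ne'
  have h2 : 1 - (u t).2.2 ≠ 0 := by linarith [ht.2.2.2]
  refine (((hasDerivAt_T h).log h1).sub
    (((hasDerivAt_T h).const_sub 1).log h2)).congr_deriv ?_
  field_simp
  ring

lemma clock_deriv_nonneg (hγ : 0 < γ) {x : State} (hx : x ∈ stateSpace n) :
    0 ≤ 1 / n * expRate n γ x * (1 - x.2.2) :=
  mul_nonneg (mul_nonneg (by positivity) (expRate_bounds hγ hx).2.2.1.le)
    (by linarith [hx.2.2.2])

/-- The left side is the derivative of `XΣ`. As `1 + q` dominates `Σ²` and `1 - Ω_φ`, it controls `1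
- X^(2n)`, so the term `-nT X^(2n)` is close to `-nT`. Terms only linear in `Σ` are split by `|Σ| ≤
η + Σ²/η`. -/
lemma virial_le {p : ℕ} (hn : 0 < n) (hp : n = 2 * p) (hγ : 0 < γ) (hν : 0 < ν) {x : State}
    (hx : x ∈ stateSpace n) {C η : ℝ} (hη : 0 < η)
    (hC : C = (1 / n) * (3 + 3 / 2 * γ) + (3 + 3 / 2 * γ) + ν) :
    (1 / n * expRate n γ x * (1 - x.2.2) * x.1 + x.2.2 * x.2.1) * x.2.1
      + x.1 * (-(3 - expRate n γ x) * (1 - x.2.2) * x.2.1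
        - n * x.2.2 * x.1 ^ (2 * n - 1) - ν * (1 - x.2.2) * x.1 ^ n * x.2.1)
      ≤ -n * x.2.2 + C * η
        + (1 / 3 + n / 3 + n / (3 / 2 * γ) + C / (3 * η)) * expRate n γ x := by
  have hn' : (0 : ℝ) < n := Nat.cast_pos.2 hn
  obtain ⟨hs, hΩ, hQ, hQ'⟩ := expRate_bounds hγ hx
  obtain ⟨hX1, hS1⟩ := abs_le_one_of_mem hn hx
  have hXn := pow_mem_of_mem hn hp hx
  have hT0 := hx.2.2.1
  have hT1 := hx.2.2.2
  have hpow : x.1 ^ (2 * n) = x.1 * x.1 ^ (2 * n - 1) := by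
    rw [← pow_succ']
    congr 1
    omega
  have hΩdef : omegaPhi n x = x.2.1 ^ 2 + x.1 ^ (2 * n) := rfl
  set Q := expRate n γ x
  set X := x.1
  set s := x.2.1
  set T := x.2.2
  have hC0 : 0 < C := by rw [hC]; positivity
  have heq : (1 / n * Q * (1 - T) * X + T * s) * s
      + X * (-(3 - Q) * (1 - T) * s - n * T * X ^ (2 * n - 1) - ν * (1 - T) * X ^ n * s)
      = T * s ^ 2 - n * T * X ^ (2 * n)
        + (1 - T) * ((1 / n * Q - (3 - Q) - ν * X ^ n) * (X * s)) := by
    rw [hpow]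
    ring
  rw [heq]
  have hcoef : |1 / n * Q - (3 - Q) - ν * X ^ n| ≤ C := by
    have e1 : 0 ≤ 1 / (n : ℝ) * Q := by positivity
    have e2 : 1 / (n : ℝ) * Q ≤ 1 / n * (3 + 3 / 2 * γ) :=
      mul_le_mul_of_nonneg_left hQ' (by positivity)
    have e3 : 0 ≤ ν * X ^ n := mul_nonneg hν.le hXn.1
    have e4 : ν * X ^ n ≤ ν * 1 := mul_le_mul_of_nonneg_left hXn.2 hν.le
    rw [hC, abs_le]
    constructor <;> linarith
  have habs : |s| ≤ η + s ^ 2 / η := by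
    have e1 : |s| * η ≤ η * η + s ^ 2 := by
      rw [← sq_abs s]
      nlinarith [sq_nonneg (|s| - η), abs_nonneg s]
    rw [← sub_nonneg] at e1 ⊢
    have : η + s ^ 2 / η - |s| = (η * η + s ^ 2 - |s| * η) / η := by field_simp
    rw [this]
    positivity
  have hmain : (1 - T) * ((1 / n * Q - (3 - Q) - ν * X ^ n) * (X * s)) ≤ C * |s| := by
    calc _ ≤ |(1 - T) * ((1 / n * Q - (3 - Q) - ν * X ^ n) * (X * s))| := le_abs_self _
      _ = |1 - T| * (|1 / n * Q - (3 - Q) - ν * X ^ n| * (|X| * |s|)) := by simp only [abs_mul]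
      _ ≤ 1 * (C * (1 * |s|)) := by
        gcongr
        rw [abs_le]
        constructor <;> linarith
      _ = C * |s| := by ring
  have h1 : C * |s| ≤ C * η + C / (3 * η) * Q := by
    calc C * |s| ≤ C * (η + s ^ 2 / η) := by gcongr
      _ = C * η + C / (3 * η) * (3 * s ^ 2) := by field_simp
      _ ≤ _ := by gcongr
  have hg : 1 - omegaPhi n x ≤ Q / (3 / 2 * γ) := by
    rw [le_div_iff₀ (by positivity)]
    linarith
  have h2 : X ^ (2 * n) = 1 - (1 - omegaPhi n x) - s ^ 2 := by rw [hΩdef]; ring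
  have h3 : 1 - Q / (3 / 2 * γ) - Q / 3 ≤ X ^ (2 * n) := by rw [h2]; linarith
  have h4 : -(n * T * X ^ (2 * n)) ≤ -n * T + (n / 3 + n / (3 / 2 * γ)) * Q := by
    have e1 := mul_le_mul_of_nonneg_left h3 (show 0 ≤ n * T by positivity)
    have e2 : 0 ≤ n * (1 - T) * (Q / (3 / 2 * γ) + Q / 3) :=
      mul_nonneg (mul_nonneg hn'.le (by linarith)) (by positivity)
    have e3 : (n / 3 + n / (3 / 2 * γ)) * Q = n * (Q / (3 / 2 * γ) + Q / 3) := by ring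
    rw [e3]
    linarith
  have h5 : T * s ^ 2 ≤ 1 / 3 * Q := by nlinarith [sq_nonneg s]
  linarith

lemma IsOrbit.tendsto_clock {p : ℕ} (hn : 0 < n) (hp : n = 2 * p) (hγ : 0 < γ) (hν : 0 < ν)
    {a : ℝ} {u : ℝ → State} (hu : IsOrbit n γ ν a u) :
    Tendsto (fun t => clock (u t)) atTop atTop := by
  have hn' : (0 : ℝ) < n := Nat.cast_pos.2 hn
  have hclock := fun t ht => hasDerivAt_clock (hu t ht).1 (hu t ht).2
  have hmono : ∀ s t, a ≤ s → s ≤ t → clock (u s) ≤ clock (u t) := fun s t has hst =>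
    le_of_hasDerivAt_nonneg hst
      (fun r hr => (hclock r (has.trans hr.1)).continuousAt.continuousWithinAt)
      (fun r hr => hclock r (has.trans hr.1.le))
      (fun r hr => clock_deriv_nonneg hγ (hu r (has.trans hr.1.le)).2)
  by_contra hnot
  have hbdd : ∃ M, ∀ t, a ≤ t → clock (u t) ≤ M := by
    by_contra! h
    refine hnot (tendsto_atTop.2 fun M => ?_)
    obtain ⟨s, hs, hM⟩ := h M
    filter_upwards [eventually_ge_atTop s] with t ht using hM.le.trans (hmono s t hs ht)
  obtain ⟨M, hM⟩ := hbdd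
  have hTmono : ∀ t, a ≤ t → (u a).2.2 ≤ (u t).2.2 := fun t ht =>
    le_of_hasDerivAt_nonneg (f := fun s => (u s).2.2) ht
      (fun r hr => (hasDerivAt_T (hu r hr.1).1).continuousAt.continuousWithinAt)
      (fun r hr => hasDerivAt_T (hu r hr.1.le).1)
      (fun r hr => by
        have h1 := (hu r hr.1.le).2
        have h2 := (expRate_bounds hγ h1).2.2.1
        have h3 := h1.2.2.1
        positivity)
  set T₀ := (u a).2.2
  have hT₀ : 0 < T₀ := (hu a le_rfl).2.2.2.1
  -- `clock ≤ M` means `1 - T ≥ T exp(-M)`, and `T ≥ T₀` by monotonicity.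
  set ε := T₀ * Real.exp (-M)
  have hε : 0 < ε := by positivity
  have hgap : ∀ t, a ≤ t → ε ≤ 1 - (u t).2.2 := by
    intro t ht
    have h1 := (hu t ht).2.2.2.1
    have h2 : 0 < 1 - (u t).2.2 := by linarith [(hu t ht).2.2.2.2]
    have h3 := hM t ht
    simp only [clock] at h3
    have h4 : Real.log (u t).2.2 + -M ≤ Real.log (1 - (u t).2.2) := by linarith
    have h5 := Real.exp_le_exp.2 h4
    rw [Real.exp_add, Real.exp_log h1, Real.exp_log h2] at h5
    exact (mul_le_mul_of_nonneg_right (hTmono t ht) (Real.exp_pos _).le).trans h5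
  obtain ⟨C, hC⟩ : ∃ C : ℝ, C = (1 / n) * (3 + 3 / 2 * γ) + (3 + 3 / 2 * γ) + ν := ⟨_, rfl⟩
  have hC0 : 0 < C := by rw [hC]; positivity
  -- Chosen so that `C η` uses up half of the drift `n T₀`.
  set η := n * T₀ / (2 * C)
  have hη : 0 < η := by positivity
  have hCη : C * η = n * T₀ / 2 := by simp only [η]; field_simp
  obtain ⟨D, hDdef⟩ : ∃ D : ℝ, D = 1 / 3 + n / 3 + n / (3 / 2 * γ) + C / (3 * η) := ⟨_, rfl⟩
  have hD : 0 < D := by rw [hDdef]; positivity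
  -- Since `1 - T ≥ ε`, the clock term absorbs `D (1 + q)` and a constant negative drift remains.
  -- The level lies one below the least value allowed by `|XΣ| ≤ 1` and `clock ≤ M`.
  have hdrift : ∀ᶠ t in atTop, (u t).1 * (u t).2.1 - D * n / ε * clock (u t)
      ≤ -1 - D * n / ε * M - 1 := by
    refine eventually_le_of_drift (κ := n * T₀ / 2) (L := fun t => t) (L' := fun _ => 1)
      (by positivity)
      (f' := fun t => ((1 / n * expRate n γ (u t) * (1 - (u t).2.2) * (u t).1
          + (u t).2.2 * (u t).2.1) * (u t).2.1
        + (u t).1 * (-(3 - expRate n γ (u t)) * (1 - (u t).2.2) * (u t).2.1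
          - n * (u t).2.2 * (u t).1 ^ (2 * n - 1)
          - ν * (1 - (u t).2.2) * (u t).1 ^ n * (u t).2.1))
        - D * n / ε * (1 / n * expRate n γ (u t) * (1 - (u t).2.2))) ?_
      (Eventually.of_forall fun t => hasDerivAt_id t) (Eventually.of_forall fun _ => zero_le_one)
      tendsto_id ?_
    · filter_upwards [eventually_ge_atTop a] with t ht
      exact ((hasDerivAt_X (hu t ht).1).mul (hasDerivAt_S (hu t ht).1)).sub
        ((hclock t ht).const_mul _)
    · filter_upwards [eventually_ge_atTop a] with t ht _
      have h1 := virial_le hn hp hγ hν (hu t ht).2 hη hC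
      have hQ := (expRate_bounds hγ (hu t ht).2).2.2.1
      have h2 : D * expRate n γ (u t)
          ≤ D * n / ε * (1 / n * expRate n γ (u t) * (1 - (u t).2.2)) := by
        have e1 : D * n / ε * (1 / n * expRate n γ (u t) * (1 - (u t).2.2))
            = D * expRate n γ (u t) * ((1 - (u t).2.2) / ε) := by field_simp
        rw [e1]
        exact le_mul_of_one_le_right (by positivity) ((one_le_div hε).2 (hgap t ht))
      have h3 := mul_le_mul_of_nonneg_left (hTmono t ht) hn'.le
      rw [hCη, ← hDdef] at h1
      linarith
  obtain ⟨t, ht, hta⟩ := (hdrift.and (eventually_ge_atTop a)).exists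
  have h1 := abs_le_one_of_mem hn (hu t hta).2
  have h2 : -1 ≤ (u t).1 * (u t).2.1 := by
    have : |(u t).1 * (u t).2.1| ≤ 1 := by
      rw [abs_mul]
      exact mul_le_one₀ h1.1 (abs_nonneg _) h1.2
    exact (abs_le.1 this).1
  have h3 := mul_le_mul_of_nonneg_left (hM t hta) (show 0 ≤ D * n / ε by positivity)
  linarith

lemma IsOrbit.tendsto_T {p : ℕ} (hn : 0 < n) (hp : n = 2 * p) (hγ : 0 < γ) (hν : 0 < ν)
    {a : ℝ} {u : ℝ → State} (hu : IsOrbit n γ ν a u) :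
    Tendsto (fun t => (u t).2.2) atTop (𝓝 1) := by
  have h1 : Tendsto (fun t => 1 - Real.exp (-clock (u t))) atTop (𝓝 (1 - 0)) :=
    tendsto_const_nhds.sub (Real.tendsto_exp_neg_atTop_nhds_zero.comp
      (hu.tendsto_clock hn hp hγ hν))
  rw [sub_zero] at h1
  refine tendsto_of_tendsto_of_tendsto_of_le_of_le' h1 tendsto_const_nhds ?_ ?_
  · filter_upwards [eventually_ge_atTop a] with t ht
    have h2 := (hu t ht).2.2.2.1
    have h3 : 0 < 1 - (u t).2.2 := by linarith [(hu t ht).2.2.2.2]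
    have h4 : Real.exp (-clock (u t)) = (1 - (u t).2.2) / (u t).2.2 := by
      rw [clock, neg_sub, Real.exp_sub, Real.exp_log h2, Real.exp_log h3]
    have h5 : 1 - (u t).2.2 ≤ Real.exp (-clock (u t)) := by
      rw [h4, le_div_iff₀ h2]
      nlinarith
    linarith
  · filter_upwards [eventually_ge_atTop a] with t ht using (hu t ht).2.2.2.2.le

/-! ### Averaging -/

/-- The part of the vector field in the `(X, Σ)` plane that vanishes on `T = 1`. -/
def perturbation (n : ℕ) (γ ν : ℝ) (z : ℝ × ℝ) : ℝ × ℝ :=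
  (1 / n * (3 * z.2 ^ 2 + 3 / 2 * γ * (1 - energy n z)) * z.1,
    -(3 - (3 * z.2 ^ 2 + 3 / 2 * γ * (1 - energy n z))) * z.2 - ν * z.1 ^ n * z.2)

lemma hasDerivAt_proj {u : ℝ → State} {t : ℝ} (h : HasDerivAt u (field n γ ν (u t)) t) :
    HasDerivAt (fun t => proj (u t)) ((u t).2.2 • frozen n (proj (u t))
      + (1 - (u t).2.2) • perturbation n γ ν (proj (u t))) t := by
  refine ((hasDerivAt_X h).prodMk (hasDerivAt_S h)).congr_deriv (Prod.ext ?_ ?_)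
  · simp only [frozen, perturbation, proj, expRate, energy, omegaPhi, Prod.fst_add, Prod.smul_fst,
      smul_eq_mul]
    ring
  · simp only [frozen, perturbation, proj, expRate, energy, omegaPhi, Prod.snd_add, Prod.smul_snd,
      smul_eq_mul]
    ring

lemma hasDerivAt_ratio {u : ℝ → State} {t : ℝ} (h : HasDerivAt u (field n γ ν (u t)) t)
    (hT : (u t).2.2 ≠ 0) :
    HasDerivAt (fun t => (1 - (u t).2.2) / (u t).2.2)
      (-(1 / n * expRate n γ (u t) * (1 - (u t).2.2) * ((1 - (u t).2.2) / (u t).2.2))) t := by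
  refine (((hasDerivAt_T h).const_sub 1).div (hasDerivAt_T h) hT).congr_deriv ?_
  field_simp
  ring

lemma IsOrbit.tendsto_ratio {p : ℕ} (hn : 0 < n) (hp : n = 2 * p) (hγ : 0 < γ) (hν : 0 < ν)
    {a : ℝ} {u : ℝ → State} (hu : IsOrbit n γ ν a u) :
    Tendsto (fun t => (1 - (u t).2.2) / (u t).2.2) atTop (𝓝 0) := by
  have h := hu.tendsto_T hn hp hγ hν
  have h1 := (h.const_sub 1).div h one_ne_zero
  rw [sub_self, zero_div] at h1
  exact h1

/-- Take `Y = Ω_φ - e B` with `e = (1 - T) / T`. Because `e T = 1 - T`, the oscillator part of `e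
B'` cancels the oscillation of `slowRate` at order `1 - T`; the remainder is `(1 - T) e R` with `R`
bounded on the state space, and `e → 0`. -/
lemma IsOrbit.exists_averaged {p : ℕ} (hn : 0 < n) (hp : n = 2 * p) (hγ : 0 < γ) (hν : 0 < ν)
    {a : ℝ} {u : ℝ → State} (hu : IsOrbit n γ ν a u) {K δ : ℝ} (hδ : 0 < δ)
    {B : ℝ × ℝ → ℝ} (hB : ContDiff ℝ 1 B) (hBm : ∀ z, energy n z ≤ 1 →
      |slowRate n γ ν z - fderiv ℝ B z (frozen n z) - meanRate n γ ν K (energy n z)| ≤ δ / 2) :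
    ∃ Y Y' : ℝ → ℝ, ∀ᶠ t in atTop, HasDerivAt Y (Y' t) t ∧
      |Y' t - (1 - (u t).2.2) * meanRate n γ ν K (omegaPhi n (u t))| ≤ δ * (1 - (u t).2.2) ∧
      |Y t - omegaPhi n (u t)| ≤ δ := by
  set R : ℝ × ℝ → ℝ := fun z => 1 / n * (3 * z.2 ^ 2 + 3 / 2 * γ * (1 - energy n z)) * B z
    - fderiv ℝ B z (perturbation n γ ν z) with hR
  have hRc : Continuous R := by
    have h1 := continuous_energy n
    have h2 : Continuous (perturbation n γ ν) := by
      unfold perturbation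
      fun_prop
    have h3 := hB.continuous
    exact Continuous.sub (by fun_prop) ((hB.continuous_fderiv one_ne_zero).clm_apply h2)
  obtain ⟨C₁, hC₁⟩ := (isCompact_closedBall (0 : ℝ × ℝ) 1).exists_bound_of_continuousOn
    hRc.continuousOn
  obtain ⟨C₂, hC₂⟩ := (isCompact_closedBall (0 : ℝ × ℝ) 1).exists_bound_of_continuousOn
    hB.continuous.continuousOn
  set e : ℝ → ℝ := fun t => (1 - (u t).2.2) / (u t).2.2 with he
  have hlim := hu.tendsto_ratio hn hp hγ hν
  have hsmall : ∀ C : ℝ, ∀ r : ℝ, 0 < r → ∀ᶠ t in atTop, e t * C ≤ r := by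
    intro C r hr
    have := hlim.mul_const C
    rw [zero_mul] at this
    exact (this.eventually_lt_const hr).mono fun t ht => ht.le
  refine ⟨fun t => omegaPhi n (u t) - e t * B (proj (u t)),
    fun t => (1 - (u t).2.2) * (slowRate n γ ν (proj (u t))
      - fderiv ℝ B (proj (u t)) (frozen n (proj (u t))) + e t * R (proj (u t))), ?_⟩
  filter_upwards [eventually_ge_atTop a, hsmall C₁ (δ / 2) (by linarith), hsmall C₂ δ hδ]
    with t ht h1 h2
  have hx := (hu t ht).2
  have hE : energy n (proj (u t)) ≤ 1 := hx.2.1.le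
  have hball : proj (u t) ∈ Metric.closedBall (0 : ℝ × ℝ) 1 := by
    rw [mem_closedBall_zero_iff]
    exact norm_le_one_of_energy_le hn hE
  have hT : (u t).2.2 ≠ 0 := hx.2.2.1.ne'
  have hT1 : 0 < 1 - (u t).2.2 := by linarith [hx.2.2.2]
  have he0 : 0 ≤ e t := div_nonneg hT1.le hx.2.2.1.le
  refine ⟨?_, ?_, ?_⟩
  · have hd1 := ((hB.differentiable one_ne_zero (proj (u t))).hasFDerivAt).comp_hasDerivAt t
      (hasDerivAt_proj (hu t ht).1)
    refine ((hasDerivAt_omegaPhi hn (hu t ht).1).sub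
      ((hasDerivAt_ratio (hu t ht).1 hT).mul hd1)).congr_deriv ?_
    simp only [map_add, map_smul, smul_eq_mul, hR, he, expRate, omegaPhi_eq_energy,
      Function.comp_apply]
    simp only [proj]
    field_simp
    ring
  · rw [← mul_sub, abs_mul, abs_of_pos hT1, mul_comm δ]
    apply mul_le_mul_of_nonneg_left _ hT1.le
    have h3 := abs_le.1 (hBm _ hE)
    have h4 := mul_le_mul_of_nonneg_left (hC₁ _ hball) he0
    rw [Real.norm_eq_abs, ← abs_of_nonneg he0, ← abs_mul, abs_of_nonneg he0] at h4
    have h5 := abs_le.1 (h4.trans h1)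
    rw [omegaPhi_eq_energy, abs_le]
    constructor <;> linarith
  · rw [show omegaPhi n (u t) - e t * B (proj (u t)) - omegaPhi n (u t)
      = -(e t * B (proj (u t))) by ring, abs_neg, abs_mul, abs_of_nonneg he0]
    exact (mul_le_mul_of_nonneg_left (hC₂ _ hball) he0).trans h2

/-- If the averaged rate is negative on `[r, 1]`, then `Ω_φ` is eventually below any level
larger than `r`. -/
lemma IsOrbit.eventually_le_of_meanRate_neg {p : ℕ} (hn : 0 < n) (hp : n = 2 * p) (hγ : 0 < γ)
    (hν : 0 < ν) {a : ℝ} {u : ℝ → State} (hu : IsOrbit n γ ν a u) {K : ℝ}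
    (hcor : ∀ δ : ℝ, 0 < δ → ∃ B : ℝ × ℝ → ℝ, ContDiff ℝ 1 B ∧ ∀ z, energy n z ≤ 1 →
      |slowRate n γ ν z - fderiv ℝ B z (frozen n z) - meanRate n γ ν K (energy n z)| ≤ δ)
    {r κ η : ℝ} (hη : 0 < η) (hκ : 0 < κ)
    (hneg : ∀ E ∈ Icc r 1, meanRate n γ ν K E ≤ -κ) :
    ∀ᶠ t in atTop, omegaPhi n (u t) ≤ r + η := by
  have hn' : (0 : ℝ) < n := Nat.cast_pos.2 hn
  -- Half of `η` pays for passing between `Y` and `Ω_φ`, half of `κ` for the averaging error. The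
  -- drift left is compared with the clock, whose rate is at most `C (1 - T)`.
  set δ := min (η / 2) (κ / 2)
  have hδ : 0 < δ := by positivity
  obtain ⟨B, hB, hBm⟩ := hcor (δ / 2) (by positivity)
  obtain ⟨Y, Y', hY⟩ := hu.exists_averaged hn hp hγ hν hδ hB hBm
  set C := 1 / n * (3 + 3 / 2 * γ) with hC
  have hCpos : 0 < C := by positivity
  have key := eventually_le_of_drift (f := Y) (f' := Y') (κ := κ / (2 * C)) (m := r + η / 2)
    (L := fun t => clock (u t)) (L' := fun t => 1 / n * expRate n γ (u t) * (1 - (u t).2.2))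
    (by positivity) (hY.mono fun t h => h.1)
    ((eventually_ge_atTop a).mono fun t ht => hasDerivAt_clock (hu t ht).1 (hu t ht).2)
    ((eventually_ge_atTop a).mono fun t ht => clock_deriv_nonneg hγ (hu t ht).2)
    (hu.tendsto_clock hn hp hγ hν) ?_
  · filter_upwards [key, hY] with t h1 h2
    have := (abs_le.1 h2.2.2).1
    have : δ ≤ η / 2 := min_le_left _ _
    linarith
  · filter_upwards [hY, eventually_ge_atTop a] with t h1 hta hle
    have hx := (hu t hta).2
    have hT1 : 0 < 1 - (u t).2.2 := by linarith [hx.2.2.2]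
    have e1 : δ ≤ η / 2 := min_le_left _ _
    have e2 : δ ≤ κ / 2 := min_le_right _ _
    have h2 := hneg (omegaPhi n (u t)) ⟨by linarith [(abs_le.1 h1.2.2).2], hx.2.1.le⟩
    have h3 := (abs_le.1 h1.2.1).2
    have h4 : Y' t ≤ -(κ / 2) * (1 - (u t).2.2) := by nlinarith
    have h5 : 1 / n * expRate n γ (u t) * (1 - (u t).2.2) ≤ C * (1 - (u t).2.2) := by
      rw [hC]
      have := (expRate_bounds hγ hx).2.2.2
      gcongr
    have h6 : κ / (2 * C) * (1 / n * expRate n γ (u t) * (1 - (u t).2.2))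
        ≤ κ / (2 * C) * (C * (1 - (u t).2.2)) := by gcongr
    have h7 : κ / (2 * C) * (C * (1 - (u t).2.2)) = κ / 2 * (1 - (u t).2.2) := by field_simp
    linarith

/-- If the averaged rate is positive on `[r₀, r]` and `Ω_φ ≥ r₀` eventually, then `Ω_φ` is
eventually above any level smaller than `r`. -/
lemma IsOrbit.eventually_ge_of_meanRate_pos {p : ℕ} (hn : 0 < n) (hp : n = 2 * p) (hγ : 0 < γ)
    (hν : 0 < ν) {a : ℝ} {u : ℝ → State} (hu : IsOrbit n γ ν a u) {K : ℝ}
    (hcor : ∀ δ : ℝ, 0 < δ → ∃ B : ℝ × ℝ → ℝ, ContDiff ℝ 1 B ∧ ∀ z, energy n z ≤ 1 →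
      |slowRate n γ ν z - fderiv ℝ B z (frozen n z) - meanRate n γ ν K (energy n z)| ≤ δ)
    {r₀ r κ η : ℝ} (hη : 0 < η) (hκ : 0 < κ) (hr₀ : ∀ᶠ t in atTop, r₀ ≤ omegaPhi n (u t))
    (hpos : ∀ E ∈ Icc r₀ r, κ ≤ meanRate n γ ν K E) :
    ∀ᶠ t in atTop, r - η ≤ omegaPhi n (u t) := by
  have hn' : (0 : ℝ) < n := Nat.cast_pos.2 hn
  set δ := min (η / 2) (κ / 2)
  have hδ : 0 < δ := by positivity
  obtain ⟨B, hB, hBm⟩ := hcor (δ / 2) (by positivity)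
  obtain ⟨Y, Y', hY⟩ := hu.exists_averaged hn hp hγ hν hδ hB hBm
  set C := 1 / n * (3 + 3 / 2 * γ) with hC
  have hCpos : 0 < C := by positivity
  have key := eventually_le_of_drift (f := fun t => -Y t) (f' := fun t => -Y' t)
    (κ := κ / (2 * C)) (m := -(r - η / 2))
    (L := fun t => clock (u t)) (L' := fun t => 1 / n * expRate n γ (u t) * (1 - (u t).2.2))
    (by positivity) (hY.mono fun t h => h.1.neg)
    ((eventually_ge_atTop a).mono fun t ht => hasDerivAt_clock (hu t ht).1 (hu t ht).2)
    ((eventually_ge_atTop a).mono fun t ht => clock_deriv_nonneg hγ (hu t ht).2)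
    (hu.tendsto_clock hn hp hγ hν) ?_
  · filter_upwards [key, hY] with t h1 h2
    have := (abs_le.1 h2.2.2).2
    have : δ ≤ η / 2 := min_le_left _ _
    linarith
  · filter_upwards [hY, eventually_ge_atTop a, hr₀] with t h1 hta hr hle
    have hx := (hu t hta).2
    have hT1 : 0 < 1 - (u t).2.2 := by linarith [hx.2.2.2]
    have e1 : δ ≤ η / 2 := min_le_left _ _
    have e2 : δ ≤ κ / 2 := min_le_right _ _
    have h2 := hpos (omegaPhi n (u t)) ⟨hr, by linarith [(abs_le.1 h1.2.2).1]⟩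
    have h3 := (abs_le.1 h1.2.1).1
    have h4 : κ / 2 * (1 - (u t).2.2) ≤ Y' t := by nlinarith
    have h5 : 1 / n * expRate n γ (u t) * (1 - (u t).2.2) ≤ C * (1 - (u t).2.2) := by
      rw [hC]
      have := (expRate_bounds hγ hx).2.2.2
      gcongr
    have h6 : κ / (2 * C) * (1 / n * expRate n γ (u t) * (1 - (u t).2.2))
        ≤ κ / (2 * C) * (C * (1 - (u t).2.2)) := by gcongr
    have h7 : κ / (2 * C) * (C * (1 - (u t).2.2)) = κ / 2 * (1 - (u t).2.2) := by field_simp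
    linarith

/-! ### Instability of the fixed point for stiff fluids -/

lemma quadratic_nonneg {a b c : ℝ} (ha : 0 < a) (h : b ^ 2 ≤ 4 * a * c) (s w : ℝ) :
    0 ≤ a * s ^ 2 + b * (w * s) + c * w ^ 2 := by
  have h1 : 4 * a * (a * s ^ 2 + b * (w * s) + c * w ^ 2)
      = (2 * a * s + b * w) ^ 2 + (4 * a * c - b ^ 2) * w ^ 2 := by ring
  have h2 : 0 ≤ (4 * a * c - b ^ 2) * w ^ 2 := mul_nonneg (by linarith) (sq_nonneg _)
  have h3 : 0 ≤ 4 * a * (a * s ^ 2 + b * (w * s) + c * w ^ 2) := by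
    rw [h1]
    positivity
  exact nonneg_of_mul_nonneg_right h3 (by positivity)

/-- Coefficients of a Lyapunov function near the fixed point: the listed inequalities hold for
all `Q` close to its limit `3 γ / 2` and all small `y`. -/
lemma exists_lyapunov_coefficients (hn : 0 < n) (hγ : 0 < γ) (hγ2 : γ < 2)
    (hγn : 2 * (n : ℝ) / ((n : ℝ) + 1) < γ) :
    ∃ α β ρ : ℝ, 0 < α ∧ 0 < β ∧ 0 < ρ ∧ α ^ 2 < 4 * β ∧
      ∀ Q y : ℝ, |Q - 3 / 2 * γ| < ρ → |y| < ρ →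
        ρ < α - 2 * (3 - Q) - 2 * y ∧ ρ < 2 * Q - n * α ∧ 0 < Q ∧
        (2 * β - (3 - Q + y) * α + 2 * Q * α / n) ^ 2
          ≤ 4 * (α - 2 * (3 - Q) - 2 * y + 2 * Q / n) * (2 * Q / n * β) := by
  have hn' : (0 : ℝ) < n := Nat.cast_pos.2 hn
  obtain ⟨g, hg⟩ : ∃ g, g = 3 / 2 * γ := ⟨_, rfl⟩
  obtain ⟨h, hh⟩ : ∃ h, h = 3 - g := ⟨_, rfl⟩
  obtain ⟨l, hl⟩ : ∃ l, l = 2 * g / n := ⟨_, rfl⟩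
  have hh0 : 0 < h := by rw [hh, hg]; linarith
  have hg0 : 0 < g := by rw [hg]; linarith
  have hl0 : 0 < l := by rw [hl]; positivity
  have hln : l * n = 2 * g := by rw [hl]; field_simp
  -- This is exactly `γ > 2n / (n + 1)`.
  have hlh : 2 * h < l := by
    rw [hl, lt_div_iff₀ hn', hh, hg]
    rw [div_lt_iff₀ (by positivity)] at hγn
    linarith
  -- At `α = 2h`, `β = h² + θ` the discriminant margin is `4θ (l(l - 2h) - θ)`, maximal for this
  -- `θ`. Moving `α` slightly above `2h` also makes the `Σ²` coefficient positive, and all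
  -- inequalities being strict, they persist for nearby `Q` and `y`.
  obtain ⟨θ, hθ⟩ : ∃ θ, θ = l * (l - 2 * h) / 2 := ⟨_, rfl⟩
  have hθ0 : 0 < θ := by
    rw [hθ]
    have := mul_pos hl0 (sub_pos.2 hlh)
    linarith
  obtain ⟨β, hβ⟩ : ∃ β, β = h ^ 2 + θ := ⟨_, rfl⟩
  have hβ0 : 0 < β := by rw [hβ]; positivity
  obtain ⟨α, hα1, hα2, hα3, hα4⟩ : ∃ α, 2 * h < α ∧ α < l ∧ α ^ 2 < 4 * β ∧
      (2 * β - h * α + l * α) ^ 2 < 4 * (α - 2 * h + l) * (l * β) := by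
    have e1 : ∀ᶠ α in 𝓝[>] (2 * h), α < l :=
      nhdsWithin_le_nhds (eventually_lt_nhds hlh)
    have e2 : ∀ᶠ α in 𝓝[>] (2 * h), α ^ 2 < 4 * β := by
      apply nhdsWithin_le_nhds
      refine ContinuousAt.eventually_lt (by fun_prop) (by fun_prop) ?_
      rw [hβ]
      nlinarith
    have e3 : ∀ᶠ α in 𝓝[>] (2 * h),
        (2 * β - h * α + l * α) ^ 2 < 4 * (α - 2 * h + l) * (l * β) := by
      apply nhdsWithin_le_nhds
      apply ContinuousAt.eventually_lt (by fun_prop) (by fun_prop)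
      rw [hβ, ← sub_pos]
      have : 4 * (2 * h - 2 * h + l) * (l * (h ^ 2 + θ))
          - (2 * (h ^ 2 + θ) - h * (2 * h) + l * (2 * h)) ^ 2
          = 4 * θ * (l * (l - 2 * h) - θ) := by ring
      rw [this, hθ]
      have := mul_pos hl0 (sub_pos.2 hlh)
      nlinarith
    obtain ⟨α, h1, h2, h3, h4⟩ := (eventually_mem_nhdsWithin.and (e1.and (e2.and e3))).exists
    exact ⟨α, h1, h2, h3, h4⟩
  have hα0 : 0 < α := by linarith
  obtain ⟨μ, hμ0, hμ1, hμ2⟩ : ∃ μ : ℝ, 0 < μ ∧ μ < α - 2 * h ∧ μ < 2 * g - n * α := by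
    have h1 : 0 < α - 2 * h := by linarith
    have h2 : 0 < 2 * g - n * α := by nlinarith
    refine ⟨min (α - 2 * h) (2 * g - n * α) / 2, by positivity, ?_, ?_⟩
    · linarith [min_le_left (α - 2 * h) (2 * g - n * α)]
    · linarith [min_le_right (α - 2 * h) (2 * g - n * α)]
  have hev : ∀ᶠ w : ℝ × ℝ in 𝓝 (g, 0),
      μ < α - 2 * (3 - w.1) - 2 * w.2 ∧ μ < 2 * w.1 - n * α ∧ 0 < w.1 ∧
        (2 * β - (3 - w.1 + w.2) * α + 2 * w.1 * α / n) ^ 2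
          < 4 * (α - 2 * (3 - w.1) - 2 * w.2 + 2 * w.1 / n) * (2 * w.1 / n * β) := by
    refine Filter.Eventually.and ?_ (Filter.Eventually.and ?_ (Filter.Eventually.and ?_ ?_))
    · refine ContinuousAt.eventually_lt (by fun_prop) (by fun_prop) ?_
      simp only
      linarith
    · refine ContinuousAt.eventually_lt (by fun_prop) (by fun_prop) ?_
      simp only
      linarith
    · refine ContinuousAt.eventually_lt (by fun_prop) (by fun_prop) ?_
      simpa using hg0
    · apply ContinuousAt.eventually_lt (by fun_prop) (by fun_prop)
      simp only
      rw [mul_div_right_comm, ← hl, ← hh, add_zero, mul_zero, sub_zero]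
      exact hα4
  obtain ⟨ρ, hρ, hball⟩ := Metric.eventually_nhds_iff_ball.1 hev
  refine ⟨α, β, min ρ μ, hα0, hβ0, by positivity, hα3, fun Q y hQ hy => ?_⟩
  rw [← hg] at hQ
  have hmem : (Q, y) ∈ Metric.ball (g, (0 : ℝ)) ρ := by
    rw [Metric.mem_ball, Prod.dist_eq, max_lt_iff]
    simp only [Real.dist_eq, sub_zero]
    exact ⟨hQ.trans_le (min_le_left _ _), hy.trans_le (min_le_left _ _)⟩
  obtain ⟨h1, h2, h3, h4⟩ := hball _ hmem
  exact ⟨(min_le_right _ _).trans_lt h1, (min_le_right _ _).trans_lt h2, h3, h4.le⟩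

/-- The product of `X` with the small parameter `(1 - T) / T`. -/
def scaledX (x : State) : ℝ := (1 - x.2.2) / x.2.2 * x.1

/-- A Lyapunov function near the fixed point. -/
def lyapunov (n : ℕ) (α β : ℝ) (x : State) : ℝ :=
  omegaPhi n x + α * (scaledX x * x.2.1) + β * scaledX x ^ 2

/-- The derivative of `lyapunov`, divided by `1 - T`. -/
def lyapunovRate (n : ℕ) (γ ν α β : ℝ) (x : State) : ℝ :=
  (α - 2 * (3 - expRate n γ x) - 2 * (ν * x.1 ^ n)) * x.2.1 ^ 2
    + (2 * expRate n γ x - n * α) * x.1 ^ (2 * n)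
    + (2 * β - (3 - expRate n γ x + ν * x.1 ^ n) * α) * (scaledX x * x.2.1)

section Derivatives
variable {u : ℝ → State} {t : ℝ} (α β : ℝ)

/-- The factor `(1 - T) / T` decays at precisely the rate of the expansion term in `X'`, so the two
cancel. -/
lemma hasDerivAt_scaledX (h : HasDerivAt u (field n γ ν (u t)) t) (hT : (u t).2.2 ≠ 0) :
    HasDerivAt (fun t => scaledX (u t)) ((1 - (u t).2.2) * (u t).2.1) t := by
  refine ((hasDerivAt_ratio h hT).mul (hasDerivAt_X h)).congr_deriv ?_
  field_simp
  ring

lemma hasDerivAt_lyapunov (hn : 0 < n) (h : HasDerivAt u (field n γ ν (u t)) t)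
    (hT : (u t).2.2 ≠ 0) :
    HasDerivAt (fun t => lyapunov n α β (u t))
      ((1 - (u t).2.2) * lyapunovRate n γ ν α β (u t)) t := by
  have hw := hasDerivAt_scaledX h hT
  refine (((hasDerivAt_omegaPhi hn h).add ((hw.mul (hasDerivAt_S h)).const_mul α)).add
    ((hw.pow 2).const_mul β)).congr_deriv ?_
  have h1 : scaledX (u t) * (n * (u t).2.2 * (u t).1 ^ (2 * n - 1))
      = (1 - (u t).2.2) * (n * (u t).1 ^ (2 * n)) := by
    have : (u t).1 ^ (2 * n) = (u t).1 * (u t).1 ^ (2 * n - 1) := by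
      rw [← pow_succ']
      congr 1
      omega
    rw [this, scaledX]
    field_simp
  have h2 : slowRate n γ ν (proj (u t)) = 2 * expRate n γ (u t) * (u t).1 ^ (2 * n)
      - 2 * (3 - expRate n γ (u t)) * (u t).2.1 ^ 2 - 2 * ν * (u t).1 ^ n * (u t).2.1 ^ 2 := by
    simp only [slowRate, expRate, proj, energy, omegaPhi]
    ring
  rw [h2]
  simp only [lyapunovRate]
  push_cast
  linear_combination (-α) * h1

lemma hasDerivAt_inv_ratio (h : HasDerivAt u (field n γ ν (u t)) t) (hT : 1 - (u t).2.2 ≠ 0) :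
    HasDerivAt (fun t => (u t).2.2 / (1 - (u t).2.2)) (1 / n * expRate n γ (u t) * (u t).2.2) t := by
  refine ((hasDerivAt_T h).div ((hasDerivAt_T h).const_sub 1) hT).congr_deriv ?_
  field_simp
  ring

/-- Dividing by `e²` adds a positive multiple of the Lyapunov function to its rate; the added `w²`
term makes the form in `(Σ, w)` nonnegative, which `lyapunovRate` alone, lacking a `w²` term, need
not be. -/
lemma hasDerivAt_lyapunov_scaled (hn : 0 < n) (h : HasDerivAt u (field n γ ν (u t)) t)
    (hT : (u t).2.2 ≠ 0) (hT1 : 1 - (u t).2.2 ≠ 0) :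
    HasDerivAt (fun t => lyapunov n α β (u t) * ((u t).2.2 / (1 - (u t).2.2)) ^ 2)
      ((1 - (u t).2.2) * ((u t).2.2 / (1 - (u t).2.2)) ^ 2 * (lyapunovRate n γ ν α β (u t)
        + 2 * expRate n γ (u t) / n * lyapunov n α β (u t))) t := by
  refine ((hasDerivAt_lyapunov α β hn h hT).mul
    ((hasDerivAt_inv_ratio h hT1).pow 2)).congr_deriv ?_
  simp only [Nat.add_one_sub_one, Nat.cast_ofNat, pow_one, Pi.pow_apply]
  field_simp

end Derivatives

lemma lyapunov_pos {α β : ℝ} (hαβ : α ^ 2 < 4 * β) {x : State} (hx : x ∈ stateSpace n) :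
    0 < lyapunov n α β x := by
  have h1 : 0 ≤ x.1 ^ (2 * n) := by rw [pow_mul]; positivity
  have heq : lyapunov n α β x = (x.2.1 + α / 2 * scaledX x) ^ 2
      + (β - α ^ 2 / 4) * scaledX x ^ 2 + x.1 ^ (2 * n) := by
    simp only [lyapunov, omegaPhi]
    ring
  have h2 : 0 ≤ (β - α ^ 2 / 4) * scaledX x ^ 2 := mul_nonneg (by linarith) (sq_nonneg _)
  by_cases hX : x.1 = 0
  · have hw : scaledX x = 0 := by simp [scaledX, hX]
    have := hx.1
    simpa [lyapunov, hw] using this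
  · have : 0 < x.1 ^ (2 * n) := by rw [pow_mul]; positivity
    rw [heq]
    positivity

lemma abs_lyapunov_sub_le {α β : ℝ} (hα : 0 < α) (hβ : 0 < β) (hn : 0 < n) {x : State}
    (hx : x ∈ stateSpace n) (he : (1 - x.2.2) / x.2.2 ≤ 1) :
    |lyapunov n α β x - omegaPhi n x| ≤ (α + β) * ((1 - x.2.2) / x.2.2) := by
  obtain ⟨hX, hS⟩ := abs_le_one_of_mem hn hx
  have he0 : 0 ≤ (1 - x.2.2) / x.2.2 := div_nonneg (by linarith [hx.2.2.2]) hx.2.2.1.le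
  have hw : |scaledX x| ≤ (1 - x.2.2) / x.2.2 := by
    rw [scaledX, abs_mul, abs_of_nonneg he0]
    exact mul_le_of_le_one_right he0 hX
  set e := (1 - x.2.2) / x.2.2
  have h1 : |scaledX x * x.2.1| ≤ e := by
    rw [abs_mul]
    exact (mul_le_of_le_one_right (abs_nonneg _) hS).trans hw
  have h2 : |scaledX x ^ 2| ≤ e := by
    rw [abs_pow]
    calc |scaledX x| ^ 2 ≤ e ^ 2 := by gcongr
      _ ≤ e := by nlinarith
  calc |lyapunov n α β x - omegaPhi n x| = |α * (scaledX x * x.2.1) + β * scaledX x ^ 2| := by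
        rw [lyapunov]
        congr 1
        ring
    _ ≤ |α * (scaledX x * x.2.1)| + |β * scaledX x ^ 2| := abs_add_le _ _
    _ = α * |scaledX x * x.2.1| + β * |scaledX x ^ 2| := by
        rw [abs_mul, abs_mul β, abs_of_pos hα, abs_of_pos hβ]
    _ ≤ α * e + β * e := by gcongr
    _ = _ := by ring

/-- Above the critical equation of state no solution approaches `Ω_φ = 0`. -/
lemma IsOrbit.exists_eventually_omegaPhi_ge {p : ℕ} (hn : 0 < n) (hp : n = 2 * p) (hγ : 0 < γ)
    (hγ2 : γ < 2) (hν : 0 < ν) (hγn : 2 * (n : ℝ) / ((n : ℝ) + 1) < γ)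
    {a : ℝ} {u : ℝ → State} (hu : IsOrbit n γ ν a u) :
    ∃ r₀ : ℝ, 0 < r₀ ∧ ∀ᶠ t in atTop, r₀ ≤ omegaPhi n (u t) := by
  have hn' : (0 : ℝ) < n := Nat.cast_pos.2 hn
  obtain ⟨α, β, ρ, hα, hβ, hρ, hαβ, hcoef⟩ := exists_lyapunov_coefficients hn hγ hγ2 hγn
  -- a neighbourhood of the fixed point in which the coefficients are controlled
  obtain ⟨r, hr0, hr⟩ : ∃ r : ℝ, 0 < r ∧ ∀ x ∈ stateSpace n, omegaPhi n x ≤ r →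
      |expRate n γ x - 3 / 2 * γ| < ρ ∧ |ν * x.1 ^ n| < ρ := by
    refine ⟨min (ρ / (2 * (3 + 3 / 2 * γ))) ((ρ / (2 * ν)) ^ 2), by positivity,
      fun x hx hle => ⟨?_, ?_⟩⟩
    · have h1 := hle.trans (min_le_left _ _)
      rw [le_div_iff₀ (by positivity)] at h1
      have h2 := sq_le_omegaPhi n x
      have h3 := sq_nonneg x.2.1
      have h4 := mul_nonneg hγ.le hx.1.le
      simp only [expRate]
      rw [abs_lt]
      constructor <;> linarith
    · have h1 := hle.trans (min_le_right _ _)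
      have h2 : (x.1 ^ n) ^ 2 ≤ (ρ / (2 * ν)) ^ 2 := by
        rw [← pow_mul, mul_comm n 2]
        exact (le_add_of_nonneg_left (sq_nonneg x.2.1)).trans h1
      have h3 := abs_le_of_sq_le_sq h2 (by positivity)
      rw [abs_mul, abs_of_pos hν]
      calc ν * |x.1 ^ n| ≤ ν * (ρ / (2 * ν)) := by gcongr
        _ = ρ / 2 := by field_simp
        _ < ρ := by linarith
  set V : ℝ → ℝ := fun t => lyapunov n α β (u t)
  set e : ℝ → ℝ := fun t => (1 - (u t).2.2) / (u t).2.2 with he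
  have hlim : Tendsto e atTop (𝓝 0) := hu.tendsto_ratio hn hp hγ hν
  have hsmall : ∀ c : ℝ, 0 < c → ∀ᶠ t in atTop, e t ≤ c := fun c hc =>
    (hlim.eventually_lt_const hc).mono fun t ht => ht.le
  have hT0 : ∀ t, a ≤ t → 0 < (u t).2.2 := fun t ht => (hu t ht).2.2.2.1
  have hT1 : ∀ t, a ≤ t → 0 < 1 - (u t).2.2 := fun t ht => by linarith [(hu t ht).2.2.2.2]
  have he0 : ∀ t, a ≤ t → 0 < e t := fun t ht => div_pos (hT1 t ht) (hT0 t ht)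
  have hVΩ : ∀ c : ℝ, 0 < c → ∀ᶠ t in atTop, |V t - omegaPhi n (u t)| ≤ c := by
    intro c hc
    filter_upwards [hsmall (c / (α + β)) (by positivity), hsmall 1 one_pos,
      eventually_ge_atTop a] with t h1 h2 hta
    refine (abs_lyapunov_sub_le hα hβ hn (hu t hta).2 h2).trans ?_
    rwa [le_div_iff₀' (by positivity)] at h1
  -- first stage: the rescaled function stays away from zero
  obtain ⟨w₀, hw₀, hW⟩ : ∃ w₀ : ℝ, 0 < w₀ ∧ ∀ᶠ t in atTop, w₀ * e t ^ 2 ≤ V t := by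
    obtain ⟨b, hb⟩ := eventually_atTop.1 ((hVΩ (r / 2) (by positivity)).and
      ((hsmall (min 1 (r / 2)) (by positivity)).and (eventually_ge_atTop a)))
    have hab : a ≤ b := (hb b le_rfl).2.2
    have hinv : ∀ t, a ≤ t → V t * ((u t).2.2 / (1 - (u t).2.2)) ^ 2 = V t / e t ^ 2 := by
      intro t ht
      have h1 := hT0 t ht
      have h2 := hT1 t ht
      simp only [he]
      field_simp
    refine ⟨min (V b / e b ^ 2) 1, lt_min (div_pos (lyapunov_pos hαβ (hu b hab).2)
      (by have := he0 b hab; positivity)) one_pos, ?_⟩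
    filter_upwards [eventually_ge_atTop b] with t hbt
    have hat := hab.trans hbt
    -- While `V / e² < 1`, smallness of `e` makes `V` and hence `Ω_φ` small, so the coefficient
    -- inequalities apply and `V / e²` does not decrease.
    have key := min_le_of_deriv_nonneg_below (m := 1)
      (fun s hs => hasDerivAt_lyapunov_scaled α β hn (hu s (hab.trans hs)).1
        (hT0 s (hab.trans hs)).ne' (hT1 s (hab.trans hs)).ne') (fun s hs hlt => ?_) hbt
    · change min (V b * _) 1 ≤ V t * _ at key
      rw [hinv b hab, hinv t hat] at key
      have := he0 t hat
      rwa [le_div_iff₀ (by positivity)] at key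
    · have has := hab.trans hs
      have hx := (hu s has).2
      have hes := he0 s has
      obtain ⟨h1, h2, -⟩ := hb s hs
      change V s * _ < 1 at hlt
      rw [hinv s has, div_lt_one (by positivity)] at hlt
      have h3 : e s ^ 2 ≤ r / 2 := by
        have := h2.trans (min_le_left _ _)
        have := h2.trans (min_le_right _ _)
        nlinarith
      have hΩ : omegaPhi n (u s) ≤ r := by linarith [(abs_le.1 h1).1]
      obtain ⟨c1, c2⟩ := hr _ hx hΩ
      obtain ⟨d1, d2, d3, d4⟩ := hcoef _ _ c1 c2
      have hq := quadratic_nonneg (by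
        have : 0 < 2 * expRate n γ (u s) / n := by positivity
        linarith) d4 (u s).2.1 (scaledX (u s))
      have hX : 0 ≤ (u s).1 ^ (2 * n) := by rw [pow_mul]; positivity
      have hX' : 0 ≤ (2 * expRate n γ (u s) - n * α + 2 * expRate n γ (u s) / n)
          * (u s).1 ^ (2 * n) :=
        mul_nonneg (by
          have : 0 < 2 * expRate n γ (u s) / n := by positivity
          linarith) hX
      have hsum : 0 ≤ lyapunovRate n γ ν α β (u s)
          + 2 * expRate n γ (u s) / n * lyapunov n α β (u s) := by
        simp only [lyapunovRate, lyapunov, omegaPhi]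
        refine (add_nonneg hq hX').trans (le_of_eq ?_)
        ring
      have := hT1 s has
      positivity
  -- second stage: the unscaled function does not decrease near the fixed point
  obtain ⟨b₀, hb₀⟩ : ∃ b₀ : ℝ, b₀ = 2 * β + (3 + 3 / 2 * γ + 3 + ν) * α := ⟨_, rfl⟩
  have hb₀pos : 0 < b₀ := by rw [hb₀]; positivity
  -- With `b₀` bounding the coefficient of `w Σ`, the estimate `w² ≤ κ Ω_φ` bounds the cross term by
  -- `ρ Ω_φ`, which the diagonal terms dominate.
  obtain ⟨κ, hκ⟩ : ∃ κ : ℝ, κ = ρ ^ 2 / b₀ ^ 2 := ⟨_, rfl⟩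
  have hκ0 : 0 < κ := by rw [hκ]; positivity
  obtain ⟨C, hC⟩ : ∃ C : ℝ, C = (1 + α / 2) / κ + α / 2 + β := ⟨_, rfl⟩
  have hC0 : 0 < C := by rw [hC]; positivity
  -- Otherwise `w₀ e² ≤ V ≤ C w² = C e² X²`, so `X² ≥ w₀ / C` and `Ω_φ` is at least a fixed multiple
  -- of `X²`, whereas `w² = e² X²` with `e → 0`.
  have hsmallX : ∀ᶠ t in atTop, scaledX (u t) ^ 2 ≤ κ * omegaPhi n (u t) := by
    filter_upwards [hW, hsmall (min 1 (κ * (w₀ / C) ^ (n - 1))) (by positivity),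
      eventually_ge_atTop a] with t h1 h2 hta
    by_contra! hlt
    have hx := (hu t hta).2
    have het := he0 t hta
    have e1 : lyapunov n α β (u t) ≤ C * scaledX (u t) ^ 2 := by
      have f1 : omegaPhi n (u t) ≤ scaledX (u t) ^ 2 / κ := by
        rw [le_div_iff₀' hκ0]
        exact hlt.le
      have f2 : scaledX (u t) * (u t).2.1 ≤ (scaledX (u t) ^ 2 + omegaPhi n (u t)) / 2 := by
        have := sq_le_omegaPhi n (u t)
        nlinarith [sq_nonneg (scaledX (u t) - (u t).2.1)]
      have f3 := mul_le_mul_of_nonneg_left f2 hα.le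
      have f4 := mul_le_mul_of_nonneg_left f1 (show 0 ≤ 1 + α / 2 by positivity)
      have f5 : (1 + α / 2) * (scaledX (u t) ^ 2 / κ)
          = (1 + α / 2) / κ * scaledX (u t) ^ 2 := by ring
      rw [lyapunov, hC]
      linarith
    have e2 : scaledX (u t) ^ 2 = e t ^ 2 * (u t).1 ^ 2 := mul_pow _ _ _
    have e3 : w₀ / C ≤ (u t).1 ^ 2 := by
      rw [div_le_iff₀ hC0]
      have := h1.trans e1
      rw [e2] at this
      have h3 : e t ^ 2 * w₀ ≤ e t ^ 2 * ((u t).1 ^ 2 * C) := by linarith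
      exact le_of_mul_le_mul_left h3 (by positivity)
    have hX2 : 0 < (u t).1 ^ 2 := lt_of_lt_of_le (by positivity) e3
    have e4 : (w₀ / C) ^ (n - 1) * (u t).1 ^ 2 ≤ (u t).1 ^ (2 * n) := by
      have : (u t).1 ^ (2 * n) = ((u t).1 ^ 2) ^ (n - 1) * (u t).1 ^ 2 := by
        rw [← pow_succ, ← pow_mul]
        congr 2
        omega
      rw [this]
      gcongr
    have e5 : (u t).1 ^ (2 * n) ≤ omegaPhi n (u t) := le_add_of_nonneg_left (sq_nonneg _)
    have e6 : e t ^ 2 ≤ κ * (w₀ / C) ^ (n - 1) := by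
      have := h2.trans (min_le_left _ _)
      have := h2.trans (min_le_right _ _)
      nlinarith
    have e7 := mul_le_mul_of_nonneg_right e6 hX2.le
    have e8 := mul_le_mul_of_nonneg_left (e4.trans e5) hκ0.le
    rw [e2] at hlt
    linarith
  obtain ⟨b, hb⟩ := eventually_atTop.1 ((hVΩ (r / 2) (by positivity)).and
    (hsmallX.and (eventually_ge_atTop a)))
  have hab : a ≤ b := (hb b le_rfl).2.2
  have hVpos : 0 < V b := lyapunov_pos hαβ (hu b hab).2
  have hVge : ∀ t, b ≤ t → min (V b) (r / 2) ≤ V t := by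
    intro t hbt
    refine min_le_of_deriv_nonneg_below (fun s hs => hasDerivAt_lyapunov α β hn
      (hu s (hab.trans hs)).1 (hT0 s (hab.trans hs)).ne') (fun s hs hlt => ?_) hbt
    have has := hab.trans hs
    have hx := (hu s has).2
    obtain ⟨h1, h2, -⟩ := hb s hs
    change V s < r / 2 at hlt
    have hΩ : omegaPhi n (u s) ≤ r := by linarith [(abs_le.1 h1).1]
    obtain ⟨c1, c2⟩ := hr _ hx hΩ
    obtain ⟨d1, d2, -, -⟩ := hcoef _ _ c1 c2
    have hX : 0 ≤ (u s).1 ^ (2 * n) := by rw [pow_mul]; positivity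
    refine mul_nonneg (hT1 s has).le ?_
    have hQ := expRate_bounds hγ hx
    have hXn := pow_mem_of_mem hn hp hx
    have hbb : |2 * β - (3 - expRate n γ (u s) + ν * (u s).1 ^ n) * α| ≤ b₀ := by
      have f1 : 0 ≤ ν * (u s).1 ^ n := mul_nonneg hν.le hXn.1
      have f2 : ν * (u s).1 ^ n ≤ ν * 1 := mul_le_mul_of_nonneg_left hXn.2 hν.le
      have f3 : |(3 - expRate n γ (u s) + ν * (u s).1 ^ n)| ≤ 3 + 3 / 2 * γ + 3 + ν := by
        rw [abs_le]
        constructor <;> linarith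
      calc _ ≤ |2 * β| + |(3 - expRate n γ (u s) + ν * (u s).1 ^ n) * α| := abs_sub _ _
        _ = 2 * β + |(3 - expRate n γ (u s) + ν * (u s).1 ^ n)| * α := by
          rw [abs_mul _ α, abs_of_pos hα, abs_of_pos (by positivity)]
        _ ≤ _ := by rw [hb₀]; gcongr
    simp only [lyapunovRate]
    set k := 2 * β - (3 - expRate n γ (u s) + ν * (u s).1 ^ n) * α
    have g1 : ρ * (u s).2.1 ^ 2 ≤ (α - 2 * (3 - expRate n γ (u s)) - 2 * (ν * (u s).1 ^ n))
        * (u s).2.1 ^ 2 := mul_le_mul_of_nonneg_right d1.le (sq_nonneg _)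
    have g2 : ρ * (u s).1 ^ (2 * n) ≤ (2 * expRate n γ (u s) - n * α) * (u s).1 ^ (2 * n) :=
      mul_le_mul_of_nonneg_right d2.le hX
    have g3 : |k * (scaledX (u s) * (u s).2.1)| ≤ ρ * omegaPhi n (u s) := by
      have f1 : (k * (scaledX (u s) * (u s).2.1)) ^ 2 ≤ (ρ * omegaPhi n (u s)) ^ 2 := by
        calc (k * (scaledX (u s) * (u s).2.1)) ^ 2
            = k ^ 2 * (scaledX (u s) ^ 2 * (u s).2.1 ^ 2) := by ring
          _ ≤ b₀ ^ 2 * ((κ * omegaPhi n (u s)) * omegaPhi n (u s)) := by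
              have := sq_le_omegaPhi n (u s)
              have hk : k ^ 2 ≤ b₀ ^ 2 := sq_le_sq' (by linarith [(abs_le.1 hbb).1])
                (abs_le.1 hbb).2
              have := mul_nonneg hκ0.le hx.1.le
              gcongr
          _ = _ := by rw [hκ]; field_simp
      exact abs_le_of_sq_le_sq f1 (mul_nonneg hρ.le hx.1.le)
    have g4 := (abs_le.1 g3).1
    have g5 : ρ * omegaPhi n (u s) = ρ * (u s).2.1 ^ 2 + ρ * (u s).1 ^ (2 * n) := by
      rw [omegaPhi]
      ring
    linarith
  set v₀ := min (V b) (r / 2)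
  have hv₀ : 0 < v₀ := lt_min hVpos (by positivity)
  refine ⟨v₀ / 2, by positivity, ?_⟩
  filter_upwards [hVΩ (v₀ / 2) (by positivity), eventually_ge_atTop b] with t h1 hbt
  linarith [hVge t hbt, (abs_le.1 h1).2]

/-! ### Asymptotics -/

lemma MapClusterPt.eq_of_tendsto {α E : Type*} [TopologicalSpace E] {l : Filter α} {u : α → E}
    {z : E} {g : E → ℝ} {c : ℝ} (h : MapClusterPt z l u) (hg : Continuous g)
    (hc : Tendsto (fun t => g (u t)) l (𝓝 c)) : g z = c := by
  have h1 : MapClusterPt (g z) l (g ∘ u) := h.continuousAt_comp hg.continuousAt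
  have h2 : ClusterPt (g z) (𝓝 c) := ClusterPt.mono h1 hc
  exact eq_of_nhds_neBot h2

lemma continuous_omegaPhi (n : ℕ) : Continuous (omegaPhi n) := by
  unfold omegaPhi
  fun_prop

lemma IsOrbit.eventually_mem_closedBall (hn : 0 < n) {a : ℝ} {u : ℝ → State}
    (hu : IsOrbit n γ ν a u) : map u atTop ≤ 𝓟 (Metric.closedBall 0 1) := by
  rw [le_principal_iff, mem_map]
  filter_upwards [eventually_ge_atTop a] with t ht
  exact mem_closedBall_zero_iff.2 (norm_le_one_of_mem hn (hu t ht).2)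

lemma IsOrbit.mem_levelOrbit {p : ℕ} (hn : 0 < n) (hp : n = 2 * p) (hγ : 0 < γ) (hν : 0 < ν)
    {a : ℝ} {u : ℝ → State} (hu : IsOrbit n γ ν a u) {c : ℝ}
    (hc : Tendsto (fun t => omegaPhi n (u t)) atTop (𝓝 c)) {z : State}
    (hz : MapClusterPt z atTop u) : z ∈ levelOrbit n c :=
  ⟨MapClusterPt.eq_of_tendsto (g := fun x : State => x.2.2) hz (by fun_prop)
    (hu.tendsto_T hn hp hγ hν), MapClusterPt.eq_of_tendsto hz (continuous_omegaPhi n) hc⟩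

lemma field_of_T_eq_one (z : ℝ × ℝ) :
    field n γ ν (z.1, z.2, 1) = ((frozen n z).1, (frozen n z).2, 0) := by
  simp [field, frozen]

lemma hasDerivAt_embedding {v : ℝ → ℝ × ℝ} {t : ℝ} (h : HasDerivAt v (frozen n (v t)) t) :
    HasDerivAt (fun t => ((v t).1, (v t).2, (1 : ℝ)))
      (field n γ ν ((v t).1, (v t).2, 1)) t := by
  rw [field_of_T_eq_one]
  exact h.fst.prodMk (h.snd.prodMk (hasDerivAt_const t (1 : ℝ)))

lemma isPeriodicOrbit_levelOrbit {c L : ℝ} (hn : 0 < n) (hc : 0 < c) {v : ℝ → ℝ × ℝ} (hL : 0 < L)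
    (hv : ∀ t, HasDerivAt v (frozen n (v t)) t) (hE : ∀ t, energy n (v t) = c)
    (hper : Function.Periodic v L) (hsurj : ∀ z, energy n z = c → ∃ t, v t = z) :
    IsPeriodicOrbit (field n γ ν) (levelOrbit n c) := by
  refine ⟨fun t => ((v t).1, (v t).2, 1), L, fun t => hasDerivAt_embedding (hv t), hL,
    fun t => by simp only [hper t], ?_, ?_⟩
  · by_contra! h
    have h2 : ∀ t, (v t).2 = (v 0).2 := fun t => congrArg (fun x : State => x.2.1) (h t)
    obtain ⟨s, hs⟩ := hsurj (0, √c) (by simp [energy, hn.ne', Real.sq_sqrt hc.le])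
    obtain ⟨t, ht⟩ := hsurj (0, -√c) (by simp [energy, hn.ne', Real.sq_sqrt hc.le])
    have h3 := (h2 s).trans (h2 t).symm
    rw [hs, ht] at h3
    have := Real.sqrt_pos.2 hc
    simp only at h3
    linarith
  · ext x
    constructor
    · rintro ⟨t, rfl⟩
      exact ⟨rfl, hE t⟩
    · rintro ⟨h1, h2⟩
      obtain ⟨t, ht⟩ := hsurj (proj x) h2
      exact ⟨t, by simp only [ht]; exact Prod.ext rfl (Prod.ext rfl h1.symm)⟩

/-- If `Ω_φ` converges to a positive level, the orbit accumulates exactly on that level set. -/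
lemma IsOrbit.convergesToSet {p : ℕ} (hn : 0 < n) (hp : n = 2 * p) (hγ : 0 < γ) (hν : 0 < ν)
    {a : ℝ} {u : ℝ → State} (hu : IsOrbit n γ ν a u) {c L : ℝ} (hc1 : c ≤ 1)
    (hlim : Tendsto (fun t => omegaPhi n (u t)) atTop (𝓝 c)) {v : ℝ → ℝ × ℝ} (hL : 0 < L)
    (hv : ∀ t, HasDerivAt v (frozen n (v t)) t) (hE : ∀ t, energy n (v t) = c)
    (hper : Function.Periodic v L) (hsurj : ∀ z, energy n z = c → ∃ t, v t = z) :
    ConvergesToSet u (levelOrbit n c) := by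
  have hball := hu.eventually_mem_closedBall hn
  have hcomp : IsCompact (Metric.closedBall (0 : State) 1) := isCompact_closedBall 0 1
  refine ⟨?_, Subset.antisymm (fun z hz => hu.mem_levelOrbit hn hp hγ hν hlim hz) ?_⟩
  · rw [Metric.tendsto_nhds]
    intro ε hε
    have hopen : IsOpen {x : State | Metric.infDist x (levelOrbit n c) < ε} :=
      isOpen_lt (Metric.continuous_infDist_pt _) continuous_const
    have := hcomp.adherence_nhdset hball hopen fun x _ hx => by
      have : x ∈ levelOrbit n c := hu.mem_levelOrbit hn hp hγ hν hlim hx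
      simpa [Metric.infDist_zero_of_mem this] using hε
    filter_upwards [this] with t ht
    rw [Real.dist_eq, sub_zero, abs_of_nonneg Metric.infDist_nonneg]
    exact ht
  · intro z hz
    -- Compactness gives one limit point `z₀`. The periodic solution carries it to any `z` of the
    -- level in finite time, and Grönwall's inequality shows that `u` follows, so `z` is a limit
    -- point too.
    obtain ⟨z₀, -, hz₀⟩ := hcomp.exists_clusterPt hball
    obtain ⟨h1, h2⟩ := hu.mem_levelOrbit hn hp hγ hν hlim hz₀
    obtain ⟨t₀, ht₀⟩ := hsurj (proj z₀) h2
    obtain ⟨t₁, ht₁, hvt₁⟩ : ∃ t₁, t₀ ≤ t₁ ∧ v t₁ = proj z := by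
      obtain ⟨t, ht⟩ := hsurj (proj z) hz.2
      obtain ⟨s, hs, hst⟩ := hper.exists_mem_Ico hL t t₀
      exact ⟨s, hs.1, by rw [← hst, ht]⟩
    obtain ⟨G, K, M, hK, -, hG⟩ := exists_lipschitz_truncation (contDiff_field n γ ν) 1
    set w : ℝ → State := fun r => ((v (t₀ + r)).1, (v (t₀ + r)).2, 1) with hw
    have hwd : ∀ r, HasDerivAt w (G (w r)) r := by
      intro r
      have h3 := norm_le_one_of_energy_le hn ((hE (t₀ + r)).le.trans hc1)
      rw [hG _ (by
        simp only [hw, Prod.norm_def, norm_one]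
        simp only [Prod.norm_def, max_le_iff] at h3
        exact max_le h3.1 (max_le h3.2 le_rfl))]
      exact hasDerivAt_embedding (v := fun r => v (t₀ + r)) ((hv (t₀ + r)).comp_const_add t₀ r)
    have hw0 : w 0 = z₀ := by
      simp only [hw, add_zero, ht₀]
      exact Prod.ext rfl (Prod.ext rfl h1.symm)
    have hw1 : w (t₁ - t₀) = z := by
      simp only [hw, add_sub_cancel, hvt₁]
      exact Prod.ext rfl (Prod.ext rfl hz.1.symm)
    have hud : ∀ t, a ≤ t → HasDerivAt u (G (u t)) t := fun t ht => by
      rw [hG _ (norm_le_one_of_mem hn (hu t ht).2)]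
      exact (hu t ht).1
    have hgron : ∀ τ, a ≤ τ →
        dist (u (τ + (t₁ - t₀))) z ≤ dist (u τ) z₀ * Real.exp (K * (t₁ - t₀)) := by
      intro τ hτ
      have hf : ∀ r ∈ Icc 0 (t₁ - t₀), HasDerivAt (fun r => u (τ + r)) (G (u (τ + r))) r :=
        fun r hr => (hud (τ + r) (by linarith [hr.1])).comp_const_add τ r
      have := dist_le_of_trajectories_ODE (v := fun _ => G) (K := K) (a := 0) (b := t₁ - t₀)
        (f := fun r => u (τ + r)) (g := w) (δ := dist (u τ) z₀) (fun _ => hK)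
        (fun r hr => (hf r hr).continuousAt.continuousWithinAt)
        (fun r hr => (hf r (Ico_subset_Icc_self hr)).hasDerivWithinAt)
        (fun r _ => (hwd r).continuousAt.continuousWithinAt)
        (fun r _ => (hwd r).hasDerivWithinAt) (by rw [hw0, add_zero])
        (t₁ - t₀) (right_mem_Icc.2 (by linarith))
      rwa [hw1, sub_zero] at this
    change MapClusterPt z atTop u
    rw [mapClusterPt_iff_frequently]
    intro s hs
    obtain ⟨ε, hε, hεs⟩ := Metric.mem_nhds_iff.1 hs
    rw [frequently_atTop]
    intro b
    have hfreq := (mapClusterPt_iff_frequently.1 hz₀) _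
      (Metric.ball_mem_nhds z₀ (show 0 < ε / Real.exp (K * (t₁ - t₀)) by positivity))
    obtain ⟨τ, hτ, hτz⟩ := frequently_atTop.1 hfreq (max a b)
    refine ⟨τ + (t₁ - t₀), by linarith [le_max_right a b], hεs ?_⟩
    rw [Metric.mem_ball, lt_div_iff₀ (Real.exp_pos _)] at hτz
    exact (hgron τ ((le_max_left a b).trans hτ)).trans_lt hτz

lemma IsOrbit.tendsto_FL1 {p : ℕ} (hn : 0 < n) (hp : n = 2 * p) (hγ : 0 < γ) (hν : 0 < ν)
    {a : ℝ} {u : ℝ → State} (hu : IsOrbit n γ ν a u)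
    (hlim : Tendsto (fun t => omegaPhi n (u t)) atTop (𝓝 0)) : Tendsto u atTop (𝓝 FL1) := by
  refine (isCompact_closedBall (0 : State) 1).le_nhds_of_unique_clusterPt
    (le_principal_iff.1 (hu.eventually_mem_closedBall hn)) fun z _ hz => ?_
  obtain ⟨h1, h2⟩ := hu.mem_levelOrbit hn hp hγ hν hlim hz
  have h3 : 0 ≤ z.1 ^ (2 * n) := by rw [pow_mul]; positivity
  have h4 := sq_nonneg z.2.1
  simp only [omegaPhi] at h2
  have h5 : z.1 = 0 := eq_zero_of_pow_eq_zero (n := 2 * n) (by linarith)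
  have h6 : z.2.1 = 0 := eq_zero_of_pow_eq_zero (n := 2) (by linarith)
  exact Prod.ext h5 (Prod.ext h6 h1)

/-- The `γ` term of `meanRate` is nonpositive here and the damping `-2νK E^(3/2)` alone supplies the
negative drift, so the critical value of `γ` is included. -/
lemma IsOrbit.tendsto_omegaPhi_zero {p : ℕ} (hn : 0 < n) (hp : n = 2 * p) (hγ : 0 < γ)
    (hν : 0 < ν) {a : ℝ} {u : ℝ → State} (hu : IsOrbit n γ ν a u) {K : ℝ} (hK : 0 < K)
    (hcor : ∀ δ : ℝ, 0 < δ → ∃ B : ℝ × ℝ → ℝ, ContDiff ℝ 1 B ∧ ∀ z, energy n z ≤ 1 →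
      |slowRate n γ ν z - fderiv ℝ B z (frozen n z) - meanRate n γ ν K (energy n z)| ≤ δ)
    (hγn : γ ≤ 2 * (n : ℝ) / ((n : ℝ) + 1)) :
    Tendsto (fun t => omegaPhi n (u t)) atTop (𝓝 0) := by
  rw [Metric.tendsto_nhds]
  intro ε hε
  have hneg : ∀ E ∈ Icc (ε / 4) 1, meanRate n γ ν K E ≤ -(2 * ν * K * (ε / 4 * √(ε / 4))) := by
    intro E hE
    have hE0 : 0 < E := by linarith [hE.1]
    have h1 : 3 * E * (1 - E) * (γ - 2 * n / (n + 1)) ≤ 0 :=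
      mul_nonpos_of_nonneg_of_nonpos (mul_nonneg (by positivity) (by linarith [hE.2]))
        (by linarith)
    have h2 : ε / 4 * √(ε / 4) ≤ E * √E :=
      mul_le_mul hE.1 (Real.sqrt_le_sqrt hE.1) (Real.sqrt_nonneg _) hE0.le
    have h3 := mul_le_mul_of_nonneg_left h2 (show 0 ≤ 2 * ν * K by positivity)
    simp only [meanRate]
    linarith
  have hκ : 0 < 2 * ν * K * (ε / 4 * √(ε / 4)) := by positivity
  filter_upwards [hu.eventually_le_of_meanRate_neg hn hp hγ hν hcor (η := ε / 4) (by positivity)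
    hκ hneg, eventually_ge_atTop a] with t h1 hta
  rw [Real.dist_eq, sub_zero, abs_of_pos (hu t hta).2.1]
  linarith

/-- `meanRate / E = 3d(1 - E) - 2νK√E` is strictly decreasing, positive at 0 and negative at 1. Its
slope is at most `-3d`, which gives the explicit margins `3dη`. -/
lemma exists_root_meanRate {K : ℝ} (hK : 0 < K) (hν : 0 < ν)
    (hγn : 2 * (n : ℝ) / ((n : ℝ) + 1) < γ) : ∃ c, 0 < c ∧ c < 1 ∧
      (∀ η, 0 < η → ∃ κ, 0 < κ ∧ ∀ E ∈ Icc (c + η) 1, meanRate n γ ν K E ≤ -κ) ∧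
      ∀ η r₀, 0 < η → 0 < r₀ → ∃ κ, 0 < κ ∧ ∀ E ∈ Icc r₀ (c - η), κ ≤ meanRate n γ ν K E := by
  obtain ⟨d, hd⟩ : ∃ d, d = γ - 2 * n / (n + 1) := ⟨_, rfl⟩
  have hd0 : 0 < d := by rw [hd]; linarith
  obtain ⟨c, ⟨hc0, hc1⟩, hc⟩ := intermediate_value_Icc' (zero_le_one (α := ℝ))
    (f := fun E => 3 * d * (1 - E) - 2 * ν * K * √E) (by fun_prop)
    (show (0 : ℝ) ∈ _ by
      simp only [Real.sqrt_one, Real.sqrt_zero]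
      constructor
      · have := mul_pos hν hK
        linarith
      · linarith)
  simp only at hc
  have hcpos : 0 < c := by
    refine hc0.lt_of_ne fun h => ?_
    rw [← h, Real.sqrt_zero] at hc
    linarith
  have hclt : c < 1 := by
    refine hc1.lt_of_ne fun h => ?_
    rw [h, Real.sqrt_one] at hc
    have := mul_pos hν hK
    linarith
  have hmean : ∀ E, meanRate n γ ν K E = E * (3 * d * (1 - E) - 2 * ν * K * √E) := by
    intro E
    simp only [meanRate, ← hd]
    ring
  have hνK : 0 ≤ 2 * ν * K := by positivity
  refine ⟨c, hcpos, hclt, fun η hη => ⟨c * (3 * d * η), by positivity, fun E hE => ?_⟩,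
    fun η r₀ hη hr₀ => ⟨r₀ * (3 * d * η), by positivity, fun E hE => ?_⟩⟩
  · have h1 : √c ≤ √E := Real.sqrt_le_sqrt (by linarith [hE.1])
    have h2 := mul_le_mul_of_nonneg_left h1 hνK
    have h3 : 3 * d * (c + η) ≤ 3 * d * E := mul_le_mul_of_nonneg_left hE.1 (by positivity)
    have h4 : 3 * d * η ≤ -(3 * d * (1 - E) - 2 * ν * K * √E) := by linarith
    have h5 := mul_le_mul (show c ≤ E by linarith [hE.1]) h4 (by positivity)
      (by linarith [hE.1])
    rw [hmean]
    linarith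
  · have h1 : √E ≤ √c := Real.sqrt_le_sqrt (by linarith [hE.2])
    have h2 := mul_le_mul_of_nonneg_left h1 hνK
    have h3 : 3 * d * E ≤ 3 * d * (c - η) := mul_le_mul_of_nonneg_left hE.2 (by positivity)
    have h4 : 3 * d * η ≤ 3 * d * (1 - E) - 2 * ν * K * √E := by linarith
    rw [hmean]
    exact mul_le_mul hE.1 h4 (by positivity) (by linarith [hE.1])

end ScalarFluid

end

open ScalarFluid in
theorem mainTheorem1 (n p : ℕ) (hn : 0 < n) (hp : n = 2 * p)
    (γ ν : ℝ) (hγ0 : 0 < γ) (hγ2 : γ < 2) (hν : 0 < ν) :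
    (∀ (τ₀ : ℝ), ∀ x₀ ∈ ScalarFluid.stateSpace n, ∃ u : ℝ → ScalarFluid.State,
      u τ₀ = x₀ ∧ ScalarFluid.IsForwardSolution (ScalarFluid.field n γ ν) τ₀ u ∧
        ∀ τ, τ₀ ≤ τ → u τ ∈ ScalarFluid.stateSpace n) ∧
    (γ ≤ 2 * (n : ℝ) / ((n : ℝ) + 1) →
      ScalarFluid.field n γ ν ScalarFluid.FL1 = 0 ∧
      ScalarFluid.omegaPf n ScalarFluid.FL1 = 1 ∧
      ∀ (τ₀ : ℝ) (u : ℝ → ScalarFluid.State),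
        ScalarFluid.IsForwardSolution (ScalarFluid.field n γ ν) τ₀ u →
        u τ₀ ∈ ScalarFluid.stateSpace n →
        Tendsto u atTop (𝓝 ScalarFluid.FL1)) ∧
    (2 * (n : ℝ) / ((n : ℝ) + 1) < γ →
      ∃ c : ℝ, 0 < c ∧ c < 1 ∧
        ScalarFluid.IsPeriodicOrbit (ScalarFluid.field n γ ν) (ScalarFluid.levelOrbit n c) ∧
        ∀ (τ₀ : ℝ) (u : ℝ → ScalarFluid.State),
          ScalarFluid.IsForwardSolution (ScalarFluid.field n γ ν) τ₀ u →
          u τ₀ ∈ ScalarFluid.stateSpace n →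
          ScalarFluid.ConvergesToSet u (ScalarFluid.levelOrbit n c)) := by
  obtain ⟨K, hK, horb, hdamp⟩ := exists_damping_corrector hn hp
  have hcor : ∀ δ : ℝ, 0 < δ → ∃ B : ℝ × ℝ → ℝ, ContDiff ℝ 1 B ∧ ∀ z, energy n z ≤ 1 →
      |slowRate n γ ν z - fderiv ℝ B z (frozen n z) - meanRate n γ ν K (energy n z)| ≤ δ := by
    intro δ hδ
    obtain ⟨f, m, hfm, hf, hm⟩ := hdamp (δ / (4 * ν)) (by positivity)
    obtain ⟨B, hB, h⟩ := hfm.exists_corrector hn (γ := γ) hν hf hm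
    refine ⟨B, hB, fun z hz => (h z hz).trans (le_of_eq ?_)⟩
    field_simp
  refine ⟨fun τ₀ x₀ hx₀ => exists_solution hn hp hγ0 hν τ₀ hx₀, fun hγn => ⟨?_, ?_, ?_⟩,
    fun hγn => ?_⟩
  · simp [field, FL1, show 2 * n - 1 ≠ 0 by omega]
  · simp [omegaPf, omegaPhi, FL1, hn.ne']
  · intro τ₀ u hu h0
    have hO := hu.isOrbit hn hp hγ0 hν h0
    exact hO.tendsto_FL1 hn hp hγ0 hν (hO.tendsto_omegaPhi_zero hn hp hγ0 hν hK hcor hγn)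
  · obtain ⟨c, hc0, hc1, hneg, hpos⟩ := exists_root_meanRate hK hν hγn
    obtain ⟨v, L, hL, hv, hE, hper, hsurj⟩ := horb c hc0
    refine ⟨c, hc0, hc1, isPeriodicOrbit_levelOrbit hn hc0 hL hv hE hper hsurj,
      fun τ₀ u hu h0 => ?_⟩
    have hO := hu.isOrbit hn hp hγ0 hν h0
    obtain ⟨r₀, hr₀, hge⟩ := hO.exists_eventually_omegaPhi_ge hn hp hγ0 hγ2 hν hγn
    refine hO.convergesToSet hn hp hγ0 hν hc1.le ?_ hL hv hE hper hsurj
    rw [Metric.tendsto_nhds]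
    intro ε hε
    obtain ⟨κ₁, hκ₁, h1⟩ := hneg (ε / 4) (by positivity)
    obtain ⟨κ₂, hκ₂, h2⟩ := hpos (ε / 4) r₀ (by positivity) hr₀
    filter_upwards [hO.eventually_le_of_meanRate_neg hn hp hγ0 hν hcor (η := ε / 4)
      (by positivity) hκ₁ h1, hO.eventually_ge_of_meanRate_pos hn hp hγ0 hν hcor (η := ε / 4)
      (by positivity) hκ₂ hge h2] with t h3 h4
    rw [Real.dist_eq, abs_lt]
    constructor <;> linarith
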